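/- Notation. Number strands $1,\dots,n$, let $B_n$ be the braid group with standard generators $\sigma_1,\dots,\sigma_{n-1}$, and let $w:B_n\to\mathbb Z$ be the writhe ($\sigma_k\mapsto 1$). Put $R=\mathbb Z[\lambda^{\pm1},\mu^{\pm1}]$, and let $\mathcal A_n$ be the free associative $R[U,V]$-algebra on $a_{ij}$, $1\le i\ne j\le n$. Let $\phi:B_n\to\operatorname{Aut}\mathcal A_n$ be the representation given, for $i,j\ne k,k+1$, by $$\phi_{\sigma_k}:\quad a_{ki}\mapsto -a_{k+1,i}-a_{k+1,k}a_{ki},\quad a_{ik}\mapsto -a_{i,k+1}-a_{ik}a_{k,k+1},\quad a_{k+1,i}\mapsto a_{ki},\quad a_{i,k+1}\mapsto a_{ik},$$ $$a_{k,k+1}\mapsto a_{k+1,k},\quad a_{k+1,k}\mapsto a_{k,k+1},\quad a_{ij}\mapsto a_{ij}.$$ View $B\in B_n$ in $B_{n+1}$ by adding a strand $n+1$, with automorphism $\phi_B^{\rm ext}$ of $\mathcal A_{n+1}$, and define $n\times n$ matrices $\Phi^L_B,\Phi^R_B$ over $\mathcal A_n$ by $\phi^{\rm ext}_B(a_{i,n+1})=\sum_\ell(\Phi^L_B)_{i\ell}a_{\ell,n+1}$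 and $\phi^{\rm ext}_B(a_{n+1,i})=\sum_\ell a_{n+1,\ell}(\Phi^R_B)_{\ell i}$. Let $\Lambda_B=\operatorname{diag}(\lambda\mu^{-w(B)},1,\dots,1)$. The transverse DGA $(CT^-_*(B),\partial^-(B))$ is the free associative $R[U,V]$-algebra on $a_{ij}$ ($i\neq j$, degree $0$), $b_{ij}$ ($i\ne j$, degree $1$), $c_{ij},d_{ij}$ (degree $1$), $e_{ij},f_{ij}$ (degree $2$), $1\le i,j\le n$, assembled in matrices $\mathbf A,\mathbf B,\mathbf C,\mathbf D,\mathbf E,\mathbf F$ (so $\mathbf A=(a_{ij})$, etc.) with $\mathbf A_{ii}=-2$ and $\mathbf B_{ii}=0$. Let $\hat{\mathbf A}$ have entries $a_{ij}$, $-1-\mu U$, $\mu Ua_{ij}$ for $i>j$, $i=j$, $i<j$ respectively, and let $\check{\mathbf A}$ have entries $Va_{ij}$, $-V-\mu$, $\mu a_{ij}$; let $\hat{\mathbf B}$ have entries $b_{ij}$, $0$, $\mu Ub_{ij}$, and $\check{\mathbf B}$ entries $Vb_{ij}$, $0$, $\mu b_{ij}$. The differential is $R[U,V]$-linear, satisfies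 $\partial(xy)=(\partial x)y+(-1)^{|x|}x\,\partial y$, and is given by $$\partial^-(\mathbf A)=0,\quad \partial^-(\mathbf B)=\mathbf A-\Lambda_B\phi_B(\mathbf A)\Lambda_B^{-1},\quad \partial^-(\mathbf C)=\hat{\mathbf A}-\Lambda_B\Phi^L_B\check{\mathbf A},\quad \partial^-(\mathbf D)=\check{\mathbf A}-\hat{\mathbf A}\Phi^R_B\Lambda_B^{-1},$$ $$\partial^-(\mathbf E)=\hat{\mathbf B}-\mathbf C-\Lambda_B\Phi^L_B\mathbf D,\quad \partial^-(\mathbf F)=\check{\mathbf B}-\mathbf D-\mathbf C\Phi^R_B\Lambda_B^{-1}.$$ Let $\operatorname{op}$ be the $R[U,V]$-linear map $\operatorname{op}(x_1\cdots x_m)=(-1)^{\sum_{i<j}|x_i||x_j|}x_m\cdots x_1$ on words in the generators, and $\partial^-_{\rm op}=\operatorname{op}\circ\partial^-\circ\operatorname{op}$. A transverse link is an equivalence class of braids (on any number of strands) under conjugation and positive (de)stabilization $B\in B_n\leftrightarrow B\sigma_n\in B_{n+1}$; the transverse mirror of the class of $B$ is the class of the braid obtained by reversing the order of the letters of $B$.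 Let $B\mapsto B^*$ be the endomorphism of $B_n$ with $\sigma_k\mapsto\sigma_{n-k}^{-1}$. Proposition. Let $B\in B_n$ be a braid whose closure is a knot, representing the transverse knot $T$. Then $(B^*)^{-1}$ represents the transverse mirror of $T$, and there is a degree-preserving isomorphism of $R[U,V]$-algebras $$\bigl(CT^-_*((B^*)^{-1}),\partial^-((B^*)^{-1})\bigr)\;\cong\;\bigl(CT^-_*(B),\partial^-_{\rm op}(B)\bigr)$$ that intertwines the differentials. In other words, the transverse DGA of the transverse mirror of $T$ is the opposite of the transverse DGA of $T$. -/

import Mathlib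

namespace TransverseHomology

noncomputable section

/-! ## Braid groups -/

/-- The Artin relations on the generators `σ_0, …, σ_{n-2}` of the braid group on `n` strands
(strands and generators are numbered from `0`). -/
def braidRels (n : ℕ) : Set (FreeGroup (Fin (n - 1))) :=
  {r | (∃ i j : Fin (n - 1), (i : ℕ) + 1 = (j : ℕ) ∧
          r = (FreeGroup.of i * FreeGroup.of j * FreeGroup.of i) *
            (FreeGroup.of j * FreeGroup.of i * FreeGroup.of j)⁻¹) ∨
       (∃ i j : Fin (n - 1), (i : ℕ) + 2 ≤ (j : ℕ) ∧
          r = (FreeGroup.of i * FreeGroup.of j) * (FreeGroup.of j * FreeGroup.of i)⁻¹)}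

/-- The braid group on `n` strands. -/
abbrev BraidGroup (n : ℕ) : Type := PresentedGroup (braidRels n)

/-- The standard generator `σ_k`, crossing the strands `k` and `k + 1`. -/
def sigma {n : ℕ} (k : Fin (n - 1)) : BraidGroup n := PresentedGroup.of k

theorem sigma_braid {n : ℕ} (i j : Fin (n - 1)) (h : (i : ℕ) + 1 = (j : ℕ)) :
    sigma i * sigma j * sigma i = sigma j * sigma i * sigma j :=
  PresentedGroup.mk_eq_mk_of_mul_inv_mem (Or.inl ⟨i, j, h, rfl⟩)

theorem sigma_comm {n : ℕ} (i j : Fin (n - 1)) (h : (i : ℕ) + 2 ≤ (j : ℕ)) :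
    sigma i * sigma j = sigma j * sigma i :=
  PresentedGroup.mk_eq_mk_of_mul_inv_mem (Or.inr ⟨i, j, h, rfl⟩)

/-- The homomorphism out of the braid group with prescribed values on the generators. -/
def braidLift {n : ℕ} {G : Type*} [Group G] (f : Fin (n - 1) → G)
    (h₁ : ∀ i j : Fin (n - 1), (i : ℕ) + 1 = (j : ℕ) → f i * f j * f i = f j * f i * f j)
    (h₂ : ∀ i j : Fin (n - 1), (i : ℕ) + 2 ≤ (j : ℕ) → f i * f j = f j * f i) :
    BraidGroup n →* G :=
  PresentedGroup.toGroup (f := f) (by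
    rintro r (⟨i, j, h, rfl⟩ | ⟨i, j, h, rfl⟩)
    · simp only [map_mul, map_inv, FreeGroup.lift_apply_of]
      rw [mul_inv_eq_one]; exact h₁ i j h
    · simp only [map_mul, map_inv, FreeGroup.lift_apply_of]
      rw [mul_inv_eq_one]; exact h₂ i j h)

theorem braidLift_sigma {n : ℕ} {G : Type*} [Group G] (f : Fin (n - 1) → G)
    (h₁ : ∀ i j : Fin (n - 1), (i : ℕ) + 1 = (j : ℕ) → f i * f j * f i = f j * f i * f j)
    (h₂ : ∀ i j : Fin (n - 1), (i : ℕ) + 2 ≤ (j : ℕ) → f i * f j = f j * f i)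
    (k : Fin (n - 1)) : braidLift f h₁ h₂ (sigma k) = f k :=
  PresentedGroup.toGroup.of _

theorem braid_hom_ext {n : ℕ} {G : Type*} [Group G] {f g : BraidGroup n →* G}
    (h : ∀ k, f (sigma k) = g (sigma k)) : f = g :=
  PresentedGroup.ext h

/-- The strand `k` (the first of the two strands crossed by `σ_k`). -/
def lo {n : ℕ} (k : Fin (n - 1)) : Fin n := ⟨k, by omega⟩

/-- The strand `k + 1` (the second of the two strands crossed by `σ_k`). -/
def hi {n : ℕ} (k : Fin (n - 1)) : Fin n := ⟨k + 1, by omega⟩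

theorem lo_ne_hi {n : ℕ} (k : Fin (n - 1)) : lo k ≠ hi k := by
  simp [lo, hi]

/-- The writhe `w : B_n → ℤ`, `σ_k ↦ 1`. -/
def writheHom (n : ℕ) : BraidGroup n →* Multiplicative ℤ :=
  braidLift (fun _ => Multiplicative.ofAdd 1) (fun _ _ _ => rfl) (fun _ _ _ => rfl)

def writhe {n : ℕ} (B : BraidGroup n) : ℤ := Multiplicative.toAdd (writheHom n B)

/-- The permutation of the strands underlying a braid. -/
def permHom (n : ℕ) : BraidGroup n →* Equiv.Perm (Fin n) :=
  braidLift (fun k => Equiv.swap (lo k) (hi k))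
    (by
      intro i j h
      have e : hi i = lo j := by simp [lo, hi, h]
      have h1 : lo i ≠ lo j := by simp [lo]; omega
      have h2 : lo i ≠ hi j := by simp [lo, hi]; omega
      have h3 : lo j ≠ hi j := lo_ne_hi j
      have l := Equiv.swap_mul_swap_mul_swap h3.symm h2.symm
      have r := Equiv.swap_mul_swap_mul_swap h1 h2
      rw [Equiv.swap_comm (lo j) (lo i), Equiv.swap_comm (hi j) (lo j)] at l
      rw [e, l, r, Equiv.swap_comm])
    (by
      intro i j h
      apply Equiv.Perm.Disjoint.commute
      intro x
      simp only [Equiv.swap_apply_def, lo, hi, Fin.ext_iff]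
      by_cases h1 : (x : ℕ) = i <;> by_cases h2 : (x : ℕ) = i + 1 <;> simp [h1, h2] <;>
        split_ifs <;> simp_all <;> omega)

/-- The number of components of the closure of a braid, that is, of cycles (fixed points
included) of its permutation. -/
def numComponents {n : ℕ} (B : BraidGroup n) : ℕ :=
  Nat.card (Quotient (Equiv.Perm.SameCycle.setoid (permHom n B)))

/-- The closure of the braid is a knot. -/
def ClosureIsKnot {n : ℕ} (B : BraidGroup n) : Prop := numComponents B = 1

/-- The homomorphism `B ↦ B^*` of `B_n`. With generators numbered `1, …, n - 1` it sends `σ_k` to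
`σ_{n-k}⁻¹`; with the numbering `0, …, n - 2` used here, `n - k` becomes `Fin.rev k`. -/
def braidStar (n : ℕ) : BraidGroup n →* BraidGroup n :=
  braidLift (fun k => (sigma k.rev)⁻¹)
    (by
      intro i j h
      have := sigma_braid j.rev i.rev (by simp only [Fin.val_rev]; omega)
      have := congrArg (·⁻¹) this
      simp only [mul_inv_rev, ← mul_assoc] at this
      exact this.symm)
    (by
      intro i j h
      have := sigma_comm j.rev i.rev (by simp only [Fin.val_rev]; omega)
      have := congrArg (·⁻¹) this
      simp only [mul_inv_rev] at this
      exact this)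

/-- The anti-automorphism of `B_n` fixing all generators, as a homomorphism to the opposite
group. -/
def revHom (n : ℕ) : BraidGroup n →* (BraidGroup n)ᵐᵒᵖ :=
  braidLift (fun k => MulOpposite.op (sigma k))
    (by
      intro i j h
      apply MulOpposite.unop_injective
      simp only [MulOpposite.unop_mul, MulOpposite.unop_op, ← mul_assoc]
      exact sigma_braid i j h)
    (by
      intro i j h
      apply MulOpposite.unop_injective
      simp only [MulOpposite.unop_mul, MulOpposite.unop_op]
      exact (sigma_comm i j h).symm)

/-- The braid obtained by reversing the order of the letters in a braid word. -/
def braidRev {n : ℕ} (B : BraidGroup n) : BraidGroup n := MulOpposite.unop (revHom n B)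

theorem braidRev_sigma {n : ℕ} (k : Fin (n - 1)) : braidRev (sigma k) = sigma k := by
  simp [braidRev, revHom, braidLift_sigma]

theorem braidRev_mul {n : ℕ} (B C : BraidGroup n) : braidRev (B * C) = braidRev C * braidRev B := by
  simp [braidRev]

theorem braidRev_inv {n : ℕ} (B : BraidGroup n) : braidRev B⁻¹ = (braidRev B)⁻¹ := by
  simp [braidRev]

/-- The generator index `k` of `B_n`, seen as a generator index of `B_{n+1}`. -/
def idxIncl {n : ℕ} (k : Fin (n - 1)) : Fin (n + 1 - 1) := ⟨k, by omega⟩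

/-- The inclusion `B_n → B_{n+1}` that adds a strand labelled `n + 1` (here: `Fin.last n`). -/
def addStrand (n : ℕ) : BraidGroup n →* BraidGroup (n + 1) :=
  braidLift (fun k => sigma (idxIncl k))
    (fun _ _ h => sigma_braid _ _ h) (fun _ _ h => sigma_comm _ _ h)

theorem braidRev_addStrand {n : ℕ} (B : BraidGroup n) :
    braidRev (addStrand n B) = addStrand n (braidRev B) := by
  have : (revHom (n + 1)).comp (addStrand n) = (MonoidHom.op (addStrand n)).comp (revHom n) := by
    apply braid_hom_ext
    intro k
    simp [addStrand, revHom, braidLift_sigma]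
  have h := DFunLike.congr_fun this B
  exact congrArg MulOpposite.unop h

/-! ## Transverse links and mirrors -/

/-- The elementary moves on braids (with any number of strands): conjugation, and positive
stabilization `B ∈ B_n ↦ B σ_n ∈ B_{n+1}`. -/
inductive TransverseMove : (Σ n, BraidGroup n) → (Σ n, BraidGroup n) → Prop
  | conj (n : ℕ) (B C : BraidGroup n) : TransverseMove ⟨n, B⟩ ⟨n, C * B * C⁻¹⟩
  | stab (n : ℕ) (B : BraidGroup (n + 1)) :
      TransverseMove ⟨n + 1, B⟩ ⟨n + 2, addStrand (n + 1) B * sigma (Fin.last n)⟩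

/-- Transverse links: classes of braids for the equivalence relation generated by conjugation and
positive stabilization. -/
def TransverseLink : Type := Quot TransverseMove

/-- The transverse link represented by (the closure of) a braid. -/
def transverseClosure {n : ℕ} (B : BraidGroup n) : TransverseLink := Quot.mk _ ⟨n, B⟩

theorem transverseClosure_conj {n : ℕ} (B C : BraidGroup n) :
    transverseClosure (C * B * C⁻¹) = transverseClosure B :=
  (Quot.sound (TransverseMove.conj n B C)).symm

/-- The transverse mirror: reverse the letters of a braid representing the transverse link. -/
def TransverseLink.mirror : TransverseLink → TransverseLink :=
  Quot.lift (fun B => transverseClosure (braidRev B.2)) (by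
    intro _ _ h
    cases h with
    | conj n B C =>
      show transverseClosure (braidRev B) = transverseClosure (braidRev (C * B * C⁻¹))
      have := transverseClosure_conj (braidRev B) (braidRev C)⁻¹
      rw [← this, braidRev_mul, braidRev_mul, braidRev_inv, inv_inv, mul_assoc]
    | stab n B =>
      show transverseClosure (braidRev B) =
        transverseClosure (braidRev (addStrand (n + 1) B * sigma (Fin.last n)))
      rw [braidRev_mul, braidRev_sigma, braidRev_addStrand]
      have h1 := transverseClosure_conj
        (addStrand (n + 1) (braidRev B) * sigma (Fin.last n)) (sigma (n := n + 2) (Fin.last n))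
      have h2 : transverseClosure (braidRev B) = _ := Quot.sound (TransverseMove.stab n (braidRev B))
      rw [h2]
      refine h1.symm.trans ?_
      congr 1
      group)

/-! ## Free graded algebras -/

section Graded

variable (S : Type*) [CommRing S] {X : Type*} (deg : X → ℕ)

/-- The algebra automorphism multiplying homogeneous elements of degree `k` by `(-1)^k`. -/
def signHom : FreeAlgebra S X →ₐ[S] FreeAlgebra S X :=
  FreeAlgebra.lift S (fun x => (-1) ^ deg x * FreeAlgebra.ι S x)

variable {S} in
/-- Auxiliary homomorphism `x ↦ !![(-1)^|x| x, d x; 0, x]`. -/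
def diffAux (D : X → FreeAlgebra S X) :
    FreeAlgebra S X →ₐ[S] Matrix (Fin 2) (Fin 2) (FreeAlgebra S X) :=
  FreeAlgebra.lift S (fun x =>
    !![(-1) ^ deg x * FreeAlgebra.ι S x, D x; 0, FreeAlgebra.ι S x])

variable {S} in
theorem diffAux_eq (D : X → FreeAlgebra S X) (y : FreeAlgebra S X) :
    diffAux deg D y = !![signHom S deg y, diffAux deg D y 0 1; 0, y] := by
  induction y using FreeAlgebra.induction with
  | grade0 r =>
    simp only [AlgHom.commutes]
    ext i j
    fin_cases i <;> fin_cases j <;> simp [Matrix.algebraMap_matrix_apply]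
  | grade1 x =>
    simp [diffAux, signHom]
  | mul a b ha hb =>
    rw [map_mul, ha, hb]
    ext i j
    fin_cases i <;> fin_cases j <;> simp [Matrix.mul_apply]
  | add a b ha hb =>
    rw [map_add, ha, hb]
    ext i j
    fin_cases i <;> fin_cases j <;> simp

variable {S} in
/-- The `S`-linear map on the free algebra with the given values on the generators that satisfies
the graded Leibniz rule `d (x y) = (d x) y + (-1)^|x| x (d y)`
(see `diffOf_ι`, `diffOf_algebraMap`, `diffOf_mul`). -/
def diffOf (D : X → FreeAlgebra S X) : FreeAlgebra S X →ₗ[S] FreeAlgebra S X where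
  toFun y := diffAux deg D y 0 1
  map_add' y z := by simp
  map_smul' r y := by simp

variable {S} in
theorem diffOf_ι (D : X → FreeAlgebra S X) (x : X) :
    diffOf deg D (FreeAlgebra.ι S x) = D x := by
  simp [diffOf, diffAux]

variable {S} in
theorem diffOf_algebraMap (D : X → FreeAlgebra S X) (r : S) :
    diffOf deg D (algebraMap S _ r) = 0 := by
  simp [diffOf, Matrix.algebraMap_matrix_apply]

variable {S} in
theorem diffOf_mul (D : X → FreeAlgebra S X) (y z : FreeAlgebra S X) :
    diffOf deg D (y * z) = diffOf deg D y * z + signHom S deg y * diffOf deg D z := by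
  show diffAux deg D (y * z) 0 1 = diffAux deg D y 0 1 * z + _ * diffAux deg D z 0 1
  rw [map_mul, Matrix.mul_apply, Fin.sum_univ_two]
  conv_lhs => rw [diffAux_eq deg D y, diffAux_eq deg D z]
  simp [add_comm]

/-- The product of the generators in a list. -/
def wordProd (w : List X) : FreeAlgebra S X := (w.map (FreeAlgebra.ι S)).prod

/-- The exponent `∑_{i<j} |x_i| |x_j|` for a word `x_1 ⋯ x_m`. -/
def opExponent : List X → ℕ
  | [] => 0
  | x :: w => deg x * (w.map deg).sum + opExponent w

/-- The `S`-module involution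
`op (x_1 x_2 ⋯ x_m) = (-1)^{∑_{i<j} |x_i| |x_j|} x_m ⋯ x_2 x_1`. -/
def opMap : FreeAlgebra S X →ₗ[S] FreeAlgebra S X :=
  (FreeAlgebra.basisFreeMonoid S X).constr S
    (fun w => (-1 : S) ^ opExponent deg w.toList • wordProd S w.toList.reverse)

theorem basisFreeMonoid_eq (w : FreeMonoid X) :
    FreeAlgebra.basisFreeMonoid S X w = wordProd S w.toList := by
  simp [FreeAlgebra.basisFreeMonoid, wordProd, FreeAlgebra.equivMonoidAlgebraFreeMonoid,
    FreeMonoid.lift_apply]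

theorem opMap_wordProd (w : List X) :
    opMap S deg (wordProd S w) = (-1 : S) ^ opExponent deg w • wordProd S w.reverse := by
  have h := (FreeAlgebra.basisFreeMonoid S X).constr_basis S
    (fun w => (-1 : S) ^ opExponent deg w.toList • wordProd S w.toList.reverse) (FreeMonoid.ofList w)
  rw [basisFreeMonoid_eq] at h
  exact h

/-- The homogeneous elements of degree `k`: the span of the words of total degree `k`. -/
def degreePart (k : ℕ) : Submodule S (FreeAlgebra S X) :=
  Submodule.span S {y | ∃ w : List X, (w.map deg).sum = k ∧ y = wordProd S w}

end Graded

/-! ## The braid group action on the algebra generated by the `a_{ij}` -/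

section Action

variable (S : Type*) [CommRing S]

/-- Index set of the generators `a_{ij}`, `i ≠ j`. -/
abbrev OffDiag (I : Type*) := {p : I × I // p.1 ≠ p.2}

/-- The tensor (free) algebra on the `a_{ij}`, `i ≠ j`. -/
abbrev AAlg (I : Type*) := FreeAlgebra S (OffDiag I)

/-- The matrix `𝐀`: off the diagonal its entries are the generators `a_{ij}`, on the diagonal
they are `-2`. -/
def matA (I : Type*) [DecidableEq I] : Matrix I I (AAlg S I) := fun i j =>
  if h : i ≠ j then FreeAlgebra.ι S ⟨(i, j), h⟩ else -2

variable {I : Type*} [DecidableEq I]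

/-- The values of `φ_{σ_k}` on the generators, with `p = k`, `q = k + 1`. -/
def phiGen (p q : I) (x : OffDiag I) : AAlg S I :=
  let a := matA S I
  let i := x.1.1
  let j := x.1.2
  if i = p then (if j = q then a q p else -a q j - a q p * a p j)
  else if i = q then (if j = p then a p q else a p j)
  else if j = p then -a i q - a i p * a p q
  else if j = q then a i p
  else a i j

/-- The values of `φ_{σ_k}⁻¹` on the generators, with `p = k`, `q = k + 1`. -/
def phiGenInv (p q : I) (x : OffDiag I) : AAlg S I :=
  let a := matA S I
  let i := x.1.1
  let j := x.1.2
  if i = q then (if j = p then a p q else -a p j - a p q * a q j)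
  else if i = p then (if j = q then a q p else a q j)
  else if j = q then -a i p - a i q * a q p
  else if j = p then a i q
  else a i j

def phiHom (p q : I) : AAlg S I →ₐ[S] AAlg S I := FreeAlgebra.lift S (phiGen S p q)

def phiHomInv (p q : I) : AAlg S I →ₐ[S] AAlg S I := FreeAlgebra.lift S (phiGenInv S p q)

theorem phiHom_matA (p q i j : I) (h : i ≠ j) :
    phiHom S p q (matA S I i j) =
      if i = p then (if j = q then matA S I q p else -matA S I q j - matA S I q p * matA S I p j)
      else if i = q then (if j = p then matA S I p q else matA S I p j)
      else if j = p then -matA S I i q - matA S I i p * matA S I p q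
      else if j = q then matA S I i p
      else matA S I i j := by
  conv_lhs => rw [matA, dif_pos h]
  simp [phiHom, phiGen]

theorem phiHomInv_matA (p q i j : I) (h : i ≠ j) :
    phiHomInv S p q (matA S I i j) =
      if i = q then (if j = p then matA S I p q else -matA S I p j - matA S I p q * matA S I q j)
      else if i = p then (if j = q then matA S I q p else matA S I q j)
      else if j = q then -matA S I i p - matA S I i q * matA S I q p
      else if j = p then matA S I i q
      else matA S I i j := by
  conv_lhs => rw [matA, dif_pos h]
  simp [phiHomInv, phiGenInv]

theorem AAlg_hom_ext {T : Type*} [Semiring T] [Algebra S T] {f g : AAlg S I →ₐ[S] T}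
    (h : ∀ i j, i ≠ j → f (matA S I i j) = g (matA S I i j)) : f = g := by
  apply FreeAlgebra.hom_ext
  funext ⟨⟨i, j⟩, hij⟩
  have := h i j hij
  simpa [matA, dif_pos hij] using this

/-- The automorphism `φ_{σ_k}`, with `p = k`, `q = k + 1`. -/
def phiEquiv (p q : I) (hpq : p ≠ q) : AAlg S I ≃ₐ[S] AAlg S I :=
  AlgEquiv.ofAlgHom (phiHom S p q) (phiHomInv S p q)
    (by
      apply AAlg_hom_ext
      intro i j hij
      simp only [AlgHom.comp_apply, AlgHom.id_apply]
      rw [phiHomInv_matA S p q i j hij]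
      have hqp := hpq.symm
      by_cases h1 : i = p <;> by_cases h2 : i = q <;> by_cases h3 : j = p <;>
        by_cases h4 : j = q <;> simp_all [phiHom_matA, eq_comm])
    (by
      apply AAlg_hom_ext
      intro i j hij
      simp only [AlgHom.comp_apply, AlgHom.id_apply]
      rw [phiHom_matA S p q i j hij]
      have hqp := hpq.symm
      by_cases h1 : i = p <;> by_cases h2 : i = q <;> by_cases h3 : j = p <;>
        by_cases h4 : j = q <;> simp_all [phiHomInv_matA, eq_comm])

theorem phiEquiv_matA (p q : I) (hpq : p ≠ q) (i j : I) (h : i ≠ j) :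
    phiEquiv S p q hpq (matA S I i j) =
      if i = p then (if j = q then matA S I q p else -matA S I q j - matA S I q p * matA S I p j)
      else if i = q then (if j = p then matA S I p q else matA S I p j)
      else if j = p then -matA S I i q - matA S I i p * matA S I p q
      else if j = q then matA S I i p
      else matA S I i j :=
  phiHom_matA S p q i j h

theorem AAlg_equiv_ext {f g : AAlg S I ≃ₐ[S] AAlg S I}
    (h : ∀ i j, i ≠ j → f (matA S I i j) = g (matA S I i j)) : f = g := by
  have : (f : AAlg S I →ₐ[S] AAlg S I) = g := AAlg_hom_ext S h
  ext x
  exact DFunLike.congr_fun this x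

theorem phi_comm (p q r s : I) (hpq : p ≠ q) (hrs : r ≠ s) (hpr : p ≠ r) (hps : p ≠ s)
    (hqr : q ≠ r) (hqs : q ≠ s) :
    phiEquiv S p q hpq * phiEquiv S r s hrs = phiEquiv S r s hrs * phiEquiv S p q hpq := by
  apply AAlg_equiv_ext
  intro i j hij
  simp only [AlgEquiv.mul_apply]
  rw [phiEquiv_matA S p q hpq i j hij, phiEquiv_matA S r s hrs i j hij]
  have := hpq.symm
  have := hrs.symm
  have := hpr.symm
  have := hps.symm
  have := hqr.symm
  have := hqs.symm
  have hi : i = p ∨ i = q ∨ i = r ∨ i = s ∨ (i ≠ p ∧ i ≠ q ∧ i ≠ r ∧ i ≠ s) := by tauto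
  have hj : j = p ∨ j = q ∨ j = r ∨ j = s ∨ (j ≠ p ∧ j ≠ q ∧ j ≠ r ∧ j ≠ s) := by tauto
  rcases hi with rfl | rfl | rfl | rfl | ⟨i1, i2, i3, i4⟩ <;>
    rcases hj with rfl | rfl | rfl | rfl | ⟨j1, j2, j3, j4⟩ <;>
    (try have j1' := j1.symm) <;> (try have j2' := j2.symm) <;>
    (try have j3' := j3.symm) <;> (try have j4' := j4.symm) <;>
    first
    | exact absurd rfl hij
    | (have hji := hij.symm
       simp [phiEquiv_matA, *] <;> noncomm_ring)

theorem phi_braid (p q r : I) (hpq : p ≠ q) (hqr : q ≠ r) (hpr : p ≠ r) :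
    phiEquiv S p q hpq * phiEquiv S q r hqr * phiEquiv S p q hpq =
      phiEquiv S q r hqr * phiEquiv S p q hpq * phiEquiv S q r hqr := by
  apply AAlg_equiv_ext
  intro i j hij
  simp only [AlgEquiv.mul_apply]
  rw [phiEquiv_matA S p q hpq i j hij, phiEquiv_matA S q r hqr i j hij]
  have := hpq.symm
  have := hqr.symm
  have := hpr.symm
  have hi : i = p ∨ i = q ∨ i = r ∨ (i ≠ p ∧ i ≠ q ∧ i ≠ r) := by tauto
  have hj : j = p ∨ j = q ∨ j = r ∨ (j ≠ p ∧ j ≠ q ∧ j ≠ r) := by tauto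
  rcases hi with rfl | rfl | rfl | ⟨i1, i2, i3⟩ <;>
    rcases hj with rfl | rfl | rfl | ⟨j1, j2, j3⟩ <;>
    (try have j1' := j1.symm) <;> (try have j2' := j2.symm) <;>
    (try have j3' := j3.symm) <;>
    first
    | exact absurd rfl hij
    | (have hji := hij.symm
       simp [phiEquiv_matA, *] <;> noncomm_ring)

variable {S}

/-- The representation `φ : B_n → Aut 𝒜_n`. -/
def phi (S : Type*) [CommRing S] (n : ℕ) :
    BraidGroup n →* (AAlg S (Fin n) ≃ₐ[S] AAlg S (Fin n)) :=
  braidLift (fun k => phiEquiv S (lo k) (hi k) (lo_ne_hi k))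
    (by
      intro i j h
      have e : hi i = lo j := by simp [lo, hi, h]
      have h2 : lo i ≠ hi j := by simp [lo, hi]; omega
      have := phi_braid S (lo i) (lo j) (hi j) (by simp [lo]; omega) (lo_ne_hi j) h2
      simpa only [e] using this)
    (by
      intro i j h
      apply phi_comm <;> simp [lo, hi] <;> omega)

theorem phi_sigma {n : ℕ} (k : Fin (n - 1)) :
    phi S n (sigma k) = phiEquiv S (lo k) (hi k) (lo_ne_hi k) :=
  braidLift_sigma _ _ _ k

/-- The inclusion `𝒜_n → 𝒜_{n+1}`. -/
def inclA (S : Type*) [CommRing S] (n : ℕ) : AAlg S (Fin n) →ₐ[S] AAlg S (Fin (n + 1)) :=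
  FreeAlgebra.lift S (fun x => matA S (Fin (n + 1)) x.1.1.castSucc x.1.2.castSucc)

theorem inclA_matA {n : ℕ} (i j : Fin n) :
    inclA S n (matA S (Fin n) i j) = matA S (Fin (n + 1)) i.castSucc j.castSucc := by
  by_cases h : i = j
  · subst h
    simp only [matA, ne_eq, not_true_eq_false, dite_false, map_neg]
    rw [map_ofNat]
  · conv_lhs => rw [matA, dif_pos h]
    simp [inclA]

theorem braid_induction {n : ℕ} {P : BraidGroup n → Prop} (B : BraidGroup n)
    (one : P 1) (gen : ∀ k, P (sigma k)) (gen_inv : ∀ k, P (sigma k)⁻¹)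
    (mul : ∀ B C, P B → P C → P (B * C)) : P B := by
  have hB : B ∈ Subgroup.closure (Set.range (PresentedGroup.of (rels := braidRels n))) := by
    rw [PresentedGroup.closure_range_of]; trivial
  induction hB using Subgroup.closure_induction'' with
  | mem x hx => obtain ⟨k, rfl⟩ := hx; exact gen k
  | inv_mem x hx => obtain ⟨k, rfl⟩ := hx; exact gen_inv k
  | one => exact one
  | mul x y _ _ hx hy => exact mul x y hx hy

theorem lo_idxIncl {n : ℕ} (k : Fin (n - 1)) : lo (idxIncl k) = (lo k).castSucc := rfl

theorem hi_idxIncl {n : ℕ} (k : Fin (n - 1)) : hi (idxIncl k) = (hi k).castSucc := rfl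

theorem addStrand_sigma {n : ℕ} (k : Fin (n - 1)) :
    addStrand n (sigma k) = sigma (idxIncl k) :=
  braidLift_sigma _ _ _ k

theorem phi_addStrand_inclA {n : ℕ} (B : BraidGroup n) (x : AAlg S (Fin n)) :
    phi S (n + 1) (addStrand n B) (inclA S n x) = inclA S n (phi S n B x) := by
  have key : ∀ (k : Fin (n - 1)) (x : AAlg S (Fin n)),
      phi S (n + 1) (addStrand n (sigma k)) (inclA S n x) = inclA S n (phi S n (sigma k) x) := by
    intro k x
    have : ((phi S (n + 1) (addStrand n (sigma k))).toAlgHom).comp (inclA S n) =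
        (inclA S n).comp (phi S n (sigma k)).toAlgHom := by
      apply AAlg_hom_ext
      intro i j hij
      have hij' : i.castSucc ≠ j.castSucc := by simpa using hij
      show phi S (n + 1) (addStrand n (sigma k)) (inclA S n (matA S (Fin n) i j)) =
        inclA S n (phi S n (sigma k) (matA S (Fin n) i j))
      rw [addStrand_sigma, phi_sigma, phi_sigma, inclA_matA, phiEquiv_matA _ _ _ _ _ _ hij',
        phiEquiv_matA _ _ _ _ _ _ hij]
      simp only [lo_idxIncl, hi_idxIncl, Fin.castSucc_inj]
      split_ifs <;> simp [inclA_matA]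
    exact DFunLike.congr_fun this x
  revert x
  induction B using braid_induction with
  | one => intro x; simp
  | gen k => exact key k
  | gen_inv k =>
    intro x
    have := key k (phi S n (sigma k)⁻¹ x)
    rw [← AlgEquiv.mul_apply, ← map_mul, mul_inv_cancel, map_one, AlgEquiv.one_apply] at this
    rw [← this, ← AlgEquiv.mul_apply, ← map_mul, ← map_mul, inv_mul_cancel, map_one, map_one,
      AlgEquiv.one_apply]
  | mul B C hB hC =>
    intro x
    rw [map_mul, map_mul, AlgEquiv.mul_apply, hC, hB, map_mul, AlgEquiv.mul_apply]

/-- `M` has the defining property of `Φ^L_B`: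
`φ_B^ext (a_{i,n+1}) = ∑_ℓ M_{iℓ} a_{ℓ,n+1}` for all `i`. -/
def IsPhiL {n : ℕ} (B : BraidGroup n) (M : Matrix (Fin n) (Fin n) (AAlg S (Fin n))) : Prop :=
  ∀ i, phi S (n + 1) (addStrand n B) (matA S (Fin (n + 1)) i.castSucc (Fin.last n)) =
    ∑ l, inclA S n (M i l) * matA S (Fin (n + 1)) l.castSucc (Fin.last n)

/-- `M` has the defining property of `Φ^R_B`:
`φ_B^ext (a_{n+1,i}) = ∑_ℓ a_{n+1,ℓ} M_{ℓi}` for all `i`. -/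
def IsPhiR {n : ℕ} (B : BraidGroup n) (M : Matrix (Fin n) (Fin n) (AAlg S (Fin n))) : Prop :=
  ∀ i, phi S (n + 1) (addStrand n B) (matA S (Fin (n + 1)) (Fin.last n) i.castSucc) =
    ∑ l, matA S (Fin (n + 1)) (Fin.last n) l.castSucc * inclA S n (M l i)

theorem phi_sigma_inv_apply {n : ℕ} (k : Fin (n - 1)) (x : AAlg S (Fin n)) :
    phi S n (sigma k)⁻¹ x = phiHomInv S (lo k) (hi k) x := by
  rw [map_inv, phi_sigma]
  rfl

theorem IsPhiL.mul {n : ℕ} {B C : BraidGroup n} {M N : Matrix (Fin n) (Fin n) (AAlg S (Fin n))}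
    (hM : IsPhiL B M) (hN : IsPhiL C N) : IsPhiL (B * C) (N.map (phi S n B) * M) := by
  intro i
  rw [map_mul, map_mul, AlgEquiv.mul_apply, hN i, map_sum]
  simp only [map_mul, phi_addStrand_inclA, hM _, Matrix.mul_apply, Matrix.map_apply, map_sum,
    Finset.mul_sum, Finset.sum_mul, mul_assoc]
  rw [Finset.sum_comm]

theorem IsPhiR.mul {n : ℕ} {B C : BraidGroup n} {M N : Matrix (Fin n) (Fin n) (AAlg S (Fin n))}
    (hM : IsPhiR B M) (hN : IsPhiR C N) : IsPhiR (B * C) (M * N.map (phi S n B)) := by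
  intro i
  rw [map_mul, map_mul, AlgEquiv.mul_apply, hN i, map_sum]
  simp only [map_mul, phi_addStrand_inclA, hM _, Matrix.mul_apply, Matrix.map_apply, map_sum,
    Finset.mul_sum, Finset.sum_mul, mul_assoc]
  rw [Finset.sum_comm]

theorem inclA_sum_single_left {n : ℕ} (m : Fin n) (x : AAlg S (Fin n))
    (y : Fin n → AAlg S (Fin (n + 1))) :
    ∑ l, inclA S n ((Pi.single m x : Fin n → AAlg S (Fin n)) l) * y l = inclA S n x * y m := by
  rw [Finset.sum_eq_single m] <;> simp +contextual

theorem inclA_sum_single_right {n : ℕ} (m : Fin n) (x : AAlg S (Fin n))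
    (y : Fin n → AAlg S (Fin (n + 1))) :
    ∑ l, y l * inclA S n ((Pi.single m x : Fin n → AAlg S (Fin n)) l) = y m * inclA S n x := by
  rw [Finset.sum_eq_single m] <;> simp +contextual

theorem exists_isPhiL {n : ℕ} (B : BraidGroup n) :
    ∃ M : Matrix (Fin n) (Fin n) (AAlg S (Fin n)), IsPhiL B M := by
  have rows : ∀ C : BraidGroup n, (∀ i : Fin n, ∃ r : Fin n → AAlg S (Fin n),
      phi S (n + 1) (addStrand n C) (matA S (Fin (n + 1)) i.castSucc (Fin.last n)) =
        ∑ l, inclA S n (r l) * matA S (Fin (n + 1)) l.castSucc (Fin.last n)) →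
      ∃ M : Matrix (Fin n) (Fin n) (AAlg S (Fin n)), IsPhiL C M := by
    intro C h
    choose r hr using h
    exact ⟨fun i l => r i l, hr⟩
  have last_ne : ∀ j : Fin n, Fin.last n ≠ j.castSucc := fun j => (Fin.castSucc_lt_last j).ne'
  induction B using braid_induction with
  | one =>
    refine rows _ (fun i => ⟨Pi.single i 1, ?_⟩)
    rw [inclA_sum_single_left]
    simp
  | gen k =>
    refine rows _ (fun i => ?_)
    rw [addStrand_sigma, phi_sigma, phiEquiv_matA _ _ _ _ _ _ (Fin.castSucc_lt_last i).ne]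
    simp only [lo_idxIncl, hi_idxIncl, Fin.castSucc_inj, last_ne, if_false]
    split_ifs with h1 h2
    · refine ⟨Pi.single (hi k) (-1) + Pi.single (lo k) (-matA S (Fin n) (hi k) (lo k)), ?_⟩
      subst h1
      simp only [Pi.add_apply, map_add, add_mul, Finset.sum_add_distrib]
      rw [inclA_sum_single_left, inclA_sum_single_left]
      simp [inclA_matA, sub_eq_add_neg]
    · refine ⟨Pi.single (lo k) 1, ?_⟩
      rw [inclA_sum_single_left]
      simp
    · refine ⟨Pi.single i 1, ?_⟩
      rw [inclA_sum_single_left]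
      simp
  | gen_inv k =>
    refine rows _ (fun i => ?_)
    rw [map_inv, addStrand_sigma, phi_sigma_inv_apply, phiHomInv_matA _ _ _ _ _ (Fin.castSucc_lt_last i).ne]
    simp only [lo_idxIncl, hi_idxIncl, Fin.castSucc_inj, last_ne, if_false]
    split_ifs with h1 h2
    · refine ⟨Pi.single (lo k) (-1) + Pi.single (hi k) (-matA S (Fin n) (lo k) (hi k)), ?_⟩
      subst h1
      simp only [Pi.add_apply, map_add, add_mul, Finset.sum_add_distrib]
      rw [inclA_sum_single_left, inclA_sum_single_left]
      simp [inclA_matA, sub_eq_add_neg]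
    · refine ⟨Pi.single (hi k) 1, ?_⟩
      rw [inclA_sum_single_left]
      simp
    · refine ⟨Pi.single i 1, ?_⟩
      rw [inclA_sum_single_left]
      simp
  | mul B C hB hC =>
    obtain ⟨M, hM⟩ := hB
    obtain ⟨N, hN⟩ := hC
    exact ⟨_, hM.mul hN⟩

theorem exists_isPhiR {n : ℕ} (B : BraidGroup n) :
    ∃ M : Matrix (Fin n) (Fin n) (AAlg S (Fin n)), IsPhiR B M := by
  have rows : ∀ C : BraidGroup n, (∀ i : Fin n, ∃ r : Fin n → AAlg S (Fin n),
      phi S (n + 1) (addStrand n C) (matA S (Fin (n + 1)) (Fin.last n) i.castSucc) =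
        ∑ l, matA S (Fin (n + 1)) (Fin.last n) l.castSucc * inclA S n (r l)) →
      ∃ M : Matrix (Fin n) (Fin n) (AAlg S (Fin n)), IsPhiR C M := by
    intro C h
    choose r hr using h
    exact ⟨fun l i => r i l, hr⟩
  have last_ne : ∀ j : Fin n, Fin.last n ≠ j.castSucc := fun j => (Fin.castSucc_lt_last j).ne'
  induction B using braid_induction with
  | one =>
    refine rows _ (fun i => ⟨Pi.single i 1, ?_⟩)
    rw [inclA_sum_single_right]
    simp
  | gen k =>
    refine rows _ (fun i => ?_)
    rw [addStrand_sigma, phi_sigma, phiEquiv_matA _ _ _ _ _ _ (Fin.castSucc_lt_last i).ne']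
    simp only [lo_idxIncl, hi_idxIncl, Fin.castSucc_inj, last_ne, if_false]
    split_ifs with h1 h2
    · refine ⟨Pi.single (hi k) (-1) + Pi.single (lo k) (-matA S (Fin n) (lo k) (hi k)), ?_⟩
      subst h1
      simp only [Pi.add_apply, map_add, mul_add, Finset.sum_add_distrib]
      rw [inclA_sum_single_right, inclA_sum_single_right]
      simp [inclA_matA, sub_eq_add_neg]
    · refine ⟨Pi.single (lo k) 1, ?_⟩
      rw [inclA_sum_single_right]
      simp
    · refine ⟨Pi.single i 1, ?_⟩
      rw [inclA_sum_single_right]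
      simp
  | gen_inv k =>
    refine rows _ (fun i => ?_)
    rw [map_inv, addStrand_sigma, phi_sigma_inv_apply, phiHomInv_matA _ _ _ _ _ (Fin.castSucc_lt_last i).ne']
    simp only [lo_idxIncl, hi_idxIncl, Fin.castSucc_inj, last_ne, if_false]
    split_ifs with h1 h2
    · refine ⟨Pi.single (lo k) (-1) + Pi.single (hi k) (-matA S (Fin n) (hi k) (lo k)), ?_⟩
      subst h1
      simp only [Pi.add_apply, map_add, mul_add, Finset.sum_add_distrib]
      rw [inclA_sum_single_right, inclA_sum_single_right]
      simp [inclA_matA, sub_eq_add_neg]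
    · refine ⟨Pi.single (hi k) 1, ?_⟩
      rw [inclA_sum_single_right]
      simp
    · refine ⟨Pi.single i 1, ?_⟩
      rw [inclA_sum_single_right]
      simp
  | mul B C hB hC =>
    obtain ⟨M, hM⟩ := hB
    obtain ⟨N, hN⟩ := hC
    exact ⟨_, hM.mul hN⟩

/-- Auxiliary homomorphism that reads off coefficients of `a_{m,n+1}` and `a_{n+1,m}`. -/
def coeffHom (S : Type*) [CommRing S] {n : ℕ} (m : Fin n) :
    AAlg S (Fin (n + 1)) →ₐ[S] Matrix (Fin 2) (Fin 2) (AAlg S (Fin n)) :=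
  FreeAlgebra.lift S (fun x =>
    if h : x.1.1 ≠ Fin.last n ∧ x.1.2 ≠ Fin.last n then
      !![matA S (Fin n) (x.1.1.castPred h.1) (x.1.2.castPred h.2), 0; 0, 0]
    else if x.1.1 = m.castSucc then !![0, 1; 0, 0]
    else if x.1.2 = m.castSucc then !![0, 0; 1, 0]
    else 0)

theorem coeffHom_inclA {n : ℕ} (m : Fin n) (x : AAlg S (Fin n)) :
    ∃ t, coeffHom S m (inclA S n x) = !![x, 0; 0, t] := by
  induction x using FreeAlgebra.induction with
  | grade0 r =>
    refine ⟨algebraMap S _ r, ?_⟩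
    rw [AlgHom.commutes, AlgHom.commutes]
    ext i j
    fin_cases i <;> fin_cases j <;> simp [Matrix.algebraMap_matrix_apply]
  | grade1 x =>
    obtain ⟨⟨i, j⟩, h⟩ := x
    have h' : i ≠ j := h
    have h2 : i.castSucc ≠ j.castSucc := by simpa using h'
    have e : FreeAlgebra.ι S (⟨(i, j), h⟩ : OffDiag (Fin n)) = matA S (Fin n) i j := by
      simp [matA, h']
    refine ⟨0, ?_⟩
    rw [e, inclA_matA]
    conv_lhs => rw [matA, dif_pos h2]
    rw [coeffHom, FreeAlgebra.lift_ι_apply, dif_pos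
      ⟨(Fin.castSucc_lt_last i).ne, (Fin.castSucc_lt_last j).ne⟩]
    simp
  | mul a b ha hb =>
    obtain ⟨s, hs⟩ := ha
    obtain ⟨t, ht⟩ := hb
    refine ⟨s * t, ?_⟩
    rw [map_mul, map_mul, hs, ht]
    simp
  | add a b ha hb =>
    obtain ⟨s, hs⟩ := ha
    obtain ⟨t, ht⟩ := hb
    refine ⟨s + t, ?_⟩
    rw [map_add, map_add, hs, ht]
    simp

theorem coeffHom_last {n : ℕ} (m l : Fin n) :
    coeffHom S m (matA S (Fin (n + 1)) l.castSucc (Fin.last n)) =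
      !![0, if l = m then 1 else 0; 0, 0] := by
  rw [matA, dif_pos (Fin.castSucc_lt_last l).ne, coeffHom, FreeAlgebra.lift_ι_apply]
  have : Fin.last n ≠ m.castSucc := (Fin.castSucc_lt_last m).ne'
  by_cases h : l = m
  · simp [h]
  · simp only [ne_eq, not_true_eq_false, and_false, dite_false, Fin.castSucc_inj, h, this, if_false]
    ext i j
    fin_cases i <;> fin_cases j <;> rfl

theorem coeffHom_last' {n : ℕ} (m l : Fin n) :
    coeffHom S m (matA S (Fin (n + 1)) (Fin.last n) l.castSucc) =
      !![0, 0; if l = m then 1 else 0, 0] := by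
  rw [matA, dif_pos (Fin.castSucc_lt_last l).ne', coeffHom, FreeAlgebra.lift_ι_apply]
  have : Fin.last n ≠ m.castSucc := (Fin.castSucc_lt_last m).ne'
  by_cases h : l = m
  · simp [h, this]
  · simp only [ne_eq, not_true_eq_false, false_and, dite_false, Fin.castSucc_inj, h, this, if_false]
    ext i j
    fin_cases i <;> fin_cases j <;> rfl

theorem IsPhiL.unique {n : ℕ} {B : BraidGroup n} {M N : Matrix (Fin n) (Fin n) (AAlg S (Fin n))}
    (hM : IsPhiL B M) (hN : IsPhiL B N) : M = N := by
  have key : ∀ (M : Matrix (Fin n) (Fin n) (AAlg S (Fin n))) (i m : Fin n),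
      coeffHom S m (∑ l, inclA S n (M i l) * matA S (Fin (n + 1)) l.castSucc (Fin.last n)) 0 1 =
        M i m := by
    intro M i m
    rw [map_sum, Matrix.sum_apply, Finset.sum_eq_single m]
    · obtain ⟨t, ht⟩ := coeffHom_inclA m (M i m)
      simp [ht, coeffHom_last]
    · intro l _ hl
      obtain ⟨t, ht⟩ := coeffHom_inclA m (M i l)
      simp [ht, coeffHom_last, hl]
    · simp
  ext i m
  rw [← key M, ← key N, ← hM i, ← hN i]

theorem IsPhiR.unique {n : ℕ} {B : BraidGroup n} {M N : Matrix (Fin n) (Fin n) (AAlg S (Fin n))}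
    (hM : IsPhiR B M) (hN : IsPhiR B N) : M = N := by
  have key : ∀ (M : Matrix (Fin n) (Fin n) (AAlg S (Fin n))) (i m : Fin n),
      coeffHom S m (∑ l, matA S (Fin (n + 1)) (Fin.last n) l.castSucc * inclA S n (M l i)) 1 0 =
        M m i := by
    intro M i m
    rw [map_sum, Matrix.sum_apply, Finset.sum_eq_single m]
    · obtain ⟨t, ht⟩ := coeffHom_inclA m (M m i)
      simp [ht, coeffHom_last']
    · intro l _ hl
      obtain ⟨t, ht⟩ := coeffHom_inclA m (M l i)
      simp [ht, coeffHom_last', hl]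
    · simp
  ext m i
  rw [← key M, ← key N, ← hM i, ← hN i]

/-- The matrix `Φ^L_B`, the unique one (`IsPhiL.unique`) with its defining property. -/
def PhiL (S : Type*) [CommRing S] {n : ℕ} (B : BraidGroup n) :
    Matrix (Fin n) (Fin n) (AAlg S (Fin n)) :=
  Classical.choose (exists_isPhiL (S := S) B)

/-- The matrix `Φ^R_B`, the unique one (`IsPhiR.unique`) with its defining property. -/
def PhiR (S : Type*) [CommRing S] {n : ℕ} (B : BraidGroup n) :
    Matrix (Fin n) (Fin n) (AAlg S (Fin n)) :=
  Classical.choose (exists_isPhiR (S := S) B)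

theorem isPhiL_PhiL {n : ℕ} (B : BraidGroup n) : IsPhiL B (PhiL S B) :=
  Classical.choose_spec (exists_isPhiL (S := S) B)

theorem isPhiR_PhiR {n : ℕ} (B : BraidGroup n) : IsPhiR B (PhiR S B) :=
  Classical.choose_spec (exists_isPhiR (S := S) B)

end Action

/-! ## The transverse DGA -/

section DGA

/-- The generators of the transverse algebra on `n` strands. -/
inductive Gen (n : ℕ) : Type
  | a (i j : Fin n) (h : i ≠ j)
  | b (i j : Fin n) (h : i ≠ j)
  | c (i j : Fin n)
  | d (i j : Fin n)
  | e (i j : Fin n)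
  | f (i j : Fin n)

/-- The degrees of the generators. -/
def Gen.deg {n : ℕ} : Gen n → ℕ
  | .a _ _ _ => 0
  | .b _ _ _ => 1
  | .c _ _ => 1
  | .d _ _ => 1
  | .e _ _ => 2
  | .f _ _ => 2

/-- The algebra `CT^-` on `n` strands, over a coefficient ring `S` (in the end `S = R[U,V]`). -/
abbrev CT (S : Type*) [CommRing S] (n : ℕ) := FreeAlgebra S (Gen n)

variable {S : Type*} [CommRing S] {n : ℕ}

/-- The inclusion `𝒜_n → CT^-`. -/
def toCT (S : Type*) [CommRing S] (n : ℕ) : AAlg S (Fin n) →ₐ[S] CT S n :=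
  FreeAlgebra.lift S (fun x => FreeAlgebra.ι S (Gen.a x.1.1 x.1.2 x.2))

/-- The matrix `𝐀` (diagonal entries `-2`), with entries in `CT^-`. -/
def ctA (S : Type*) [CommRing S] (n : ℕ) : Matrix (Fin n) (Fin n) (CT S n) :=
  (matA S (Fin n)).map (toCT S n)

/-- The matrix `𝐁` (diagonal entries `0`). -/
def ctB (S : Type*) [CommRing S] (n : ℕ) : Matrix (Fin n) (Fin n) (CT S n) := fun i j =>
  if h : i ≠ j then FreeAlgebra.ι S (Gen.b i j h) else 0

def ctC (S : Type*) [CommRing S] (n : ℕ) : Matrix (Fin n) (Fin n) (CT S n) := fun i j =>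
  FreeAlgebra.ι S (Gen.c i j)

def ctD (S : Type*) [CommRing S] (n : ℕ) : Matrix (Fin n) (Fin n) (CT S n) := fun i j =>
  FreeAlgebra.ι S (Gen.d i j)

/-- `𝐀` with `-1 - μU` on the diagonal and `a_{ij}` multiplied by `μU` above it. -/
def hatA (mu : Sˣ) (U : S) (n : ℕ) : Matrix (Fin n) (Fin n) (CT S n) := fun i j =>
  if j < i then ctA S n i j
  else if i = j then algebraMap S _ (-1 - mu * U)
  else (mu * U : S) • ctA S n i j

/-- `𝐀` with `-V - μ` on the diagonal, `a_{ij}` multiplied by `V` below it and by `μ` above it. -/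
def checkA (mu : Sˣ) (V : S) (n : ℕ) : Matrix (Fin n) (Fin n) (CT S n) := fun i j =>
  if j < i then V • ctA S n i j
  else if i = j then algebraMap S _ (-V - mu)
  else (mu : S) • ctA S n i j

def hatB (mu : Sˣ) (U : S) (n : ℕ) : Matrix (Fin n) (Fin n) (CT S n) := fun i j =>
  if j < i then ctB S n i j
  else if i = j then 0
  else (mu * U : S) • ctB S n i j

def checkB (mu : Sˣ) (V : S) (n : ℕ) : Matrix (Fin n) (Fin n) (CT S n) := fun i j =>
  if j < i then V • ctB S n i j
  else if i = j then 0
  else (mu : S) • ctB S n i j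

/-- The diagonal of `Λ_B = diag(λ μ^{-w(B)}, 1, …, 1)`. -/
def lamDiag (lam mu : Sˣ) (B : BraidGroup n) (i : Fin n) : Sˣ :=
  if (i : ℕ) = 0 then lam * mu ^ (-writhe B) else 1

/-- `Λ_B`. -/
def Lam (lam mu : Sˣ) (B : BraidGroup n) : Matrix (Fin n) (Fin n) (CT S n) :=
  Matrix.diagonal (fun i => algebraMap S (CT S n) (lamDiag lam mu B i : S))

/-- `Λ_B⁻¹`. -/
def LamInv (lam mu : Sˣ) (B : BraidGroup n) : Matrix (Fin n) (Fin n) (CT S n) :=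
  Matrix.diagonal (fun i => algebraMap S (CT S n) (((lamDiag lam mu B i)⁻¹ : Sˣ) : S))

theorem Lam_mul_LamInv (lam mu : Sˣ) (B : BraidGroup n) :
    Lam lam mu B * LamInv lam mu B = 1 := by
  simp [Lam, LamInv, ← map_mul]

/-- `φ_B(𝐀)`, with entries in `CT^-`. -/
def ctPhiA (S : Type*) [CommRing S] (B : BraidGroup n) : Matrix (Fin n) (Fin n) (CT S n) :=
  (matA S (Fin n)).map (fun x => toCT S n (phi S n B x))

/-- `Φ^L_B`, with entries in `CT^-`. -/
def ctPhiL (S : Type*) [CommRing S] (B : BraidGroup n) : Matrix (Fin n) (Fin n) (CT S n) :=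
  (PhiL S B).map (toCT S n)

/-- `Φ^R_B`, with entries in `CT^-`. -/
def ctPhiR (S : Type*) [CommRing S] (B : BraidGroup n) : Matrix (Fin n) (Fin n) (CT S n) :=
  (PhiR S B).map (toCT S n)

/-- The values of `∂^-(B)` on the generators. -/
def diffGen (lam mu : Sˣ) (U V : S) (B : BraidGroup n) : Gen n → CT S n
  | .a _ _ _ => 0
  | .b i j _ => (ctA S n - Lam lam mu B * ctPhiA S B * LamInv lam mu B) i j
  | .c i j => (hatA mu U n - Lam lam mu B * ctPhiL S B * checkA mu V n) i j
  | .d i j => (checkA mu V n - hatA mu U n * ctPhiR S B * LamInv lam mu B) i j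
  | .e i j => (hatB mu U n - ctC S n - Lam lam mu B * ctPhiL S B * ctD S n) i j
  | .f i j => (checkB mu V n - ctD S n - ctC S n * ctPhiR S B * LamInv lam mu B) i j

/-- The differential `∂^-(B; λ, μ, U, V)`. -/
def diffCT (lam mu : Sˣ) (U V : S) (B : BraidGroup n) : CT S n →ₗ[S] CT S n :=
  diffOf Gen.deg (diffGen lam mu U V B)

/-- The opposite differential `∂^-_op = op ∘ ∂^- ∘ op`. -/
def diffOpCT (lam mu : Sˣ) (U V : S) (B : BraidGroup n) : CT S n →ₗ[S] CT S n :=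
  opMap S Gen.deg ∘ₗ diffCT lam mu U V B ∘ₗ opMap S Gen.deg

end DGA

/-! ## The coefficient ring `R[U,V]`, `R = ℤ[λ^{±1}, μ^{±1}]` -/

section Coefficients

/-- `R = ℤ[λ^{±1}, μ^{±1}]`, as Laurent polynomials in `μ` over Laurent polynomials in `λ`. -/
abbrev BaseR : Type := LaurentPolynomial (LaurentPolynomial ℤ)

/-- `R[U,V]`; `U` and `V` are the variables `0` and `1`. -/
abbrev RUV : Type := MvPolynomial (Fin 2) BaseR

/-- The variable of a Laurent polynomial ring, as a unit. -/
def laurentUnit (A : Type) [CommRing A] : (LaurentPolynomial A)ˣ where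
  val := LaurentPolynomial.T 1
  inv := LaurentPolynomial.T (-1)
  val_inv := by rw [← LaurentPolynomial.T_add]; simp
  inv_val := by rw [← LaurentPolynomial.T_add]; simp

def lamRUV : RUVˣ :=
  Units.map (MvPolynomial.C : BaseR →+* RUV).toMonoidHom
    (Units.map (LaurentPolynomial.C : LaurentPolynomial ℤ →+* BaseR).toMonoidHom (laurentUnit ℤ))

def muRUV : RUVˣ :=
  Units.map (MvPolynomial.C : BaseR →+* RUV).toMonoidHom (laurentUnit (LaurentPolynomial ℤ))

def URUV : RUV := MvPolynomial.X 0

def VRUV : RUV := MvPolynomial.X 1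

/-- The differential `∂^-(B)` of the transverse DGA of `B` over `R[U,V]`. -/
def dMinus {n : ℕ} (B : BraidGroup n) : CT RUV n →ₗ[RUV] CT RUV n :=
  diffCT lamRUV muRUV URUV VRUV B

/-- The opposite differential `∂^-_op(B)` over `R[U,V]`. -/
def dMinusOp {n : ℕ} (B : BraidGroup n) : CT RUV n →ₗ[RUV] CT RUV n :=
  diffOpCT lamRUV muRUV URUV VRUV B

end Coefficients

end

end TransverseHomology

open TransverseHomology

/-! Mirror. Write G = B^*. For a word σ_{k₁}⋯σ_{k_m} representing B, G⁻¹ is the reversed word with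
every index k replaced by n − k. Conjugation by the half twist Δ makes exactly this replacement of
indices, so G⁻¹ is conjugate to the reversal of B (`exists_conj_sigma_rev`,
`transverseClosure_braidStar_inv`).

The isomorphism is a composite of two maps.

Reflection. The anti-automorphism a_{ij} ↦ a_{n+1−j,n+1−i} intertwines φ_B with φ_G: φ_{σ_k}⁻¹ is
φ_{σ_k} with the strands k and k + 1 exchanged, and reversing the order of the strands makes the
same exchange. Hence reflection in the antidiagonal turns Φ^L_B into Φ^R_G and Φ^R_B into Φ^L_G
(`PhiR_braidStar`, `PhiL_braidStar`), and it fixes the matrices with hats and checks because it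
preserves the positions below and above the diagonal. On generators ∂^- takes values of degree at
most 1, where `op` carries no sign, so ∂^-_op(B) is the derivation with plainly reversed values.
Reflecting indices carries it to a differential δ in which the left and right factors have traded
places: with Λ' = diag(1, …, 1, λμ^{−w(B)}), L = Λ'⁻¹Φ^L_G and R = Φ^R_GΛ', one has δ𝐁 = 𝐀 −
Λ'⁻¹φ_G(𝐀)Λ', δ𝐂 = Â − ǍR, δ𝐃 = Ǎ − LÂ, δ𝐄 = B̂ − 𝐂 − 𝐃R, δ𝐅 = B̌ − 𝐃 − L𝐂 (`reflectHom_diffOf`).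

Passing from G⁻¹ to G. Let Λ = Λ_{G⁻¹}. The map Ψ from the DGA of G⁻¹ to δ applies φ_G to the
a_{ij}, which replaces Φ^L and Φ^R of G⁻¹ by the inverses of those of G, and then rescales a_{ij} by
κ_iκ_j⁻¹. With N = Λκ and up to conjugation by N, it sends 𝐁 to −𝐁, 𝐂 to −B̂ + L⁻¹(B̌ − 𝐃), 𝐃 to −B̌
+ (B̂ − 𝐂)R⁻¹, and 𝐄, 𝐅 to −L⁻¹𝐄R⁻¹, −L⁻¹𝐅R⁻¹; compatibility with the differentials is then matrix
algebra (`mirrorHom_diffGen`).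

The rescaling moves the marked strand from the first position (Λ) to the last (Λ'). With π the
permutation of G, it requires κ∘π = ΛκΛ'⁻¹. The writhes of G⁻¹ and B agree, so the two nontrivial
entries are the same unit, and this equation can be solved as soon as the first and last strands lie
in one cycle of π (`exists_cochain`, `exists_rescaling`). For a knot they do. -/

namespace TransverseHomology

noncomputable section

/-! ## The half twist and the mirror -/

section HalfTwist

variable {G : Type*} [Group G]

/-- The product `s_0 s_1 ⋯ s_{m-1}`. -/
def ascProd (s : ℕ → G) : ℕ → G
  | 0 => 1
  | m + 1 => ascProd s m * s m

/-- The product `s_{m-1} ⋯ s_1 s_0`. -/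
def descProd (s : ℕ → G) : ℕ → G
  | 0 => 1
  | m + 1 => s m * descProd s m

/-- The half twist in the letters `s_0, …, s_{m-1}`. -/
def halfTwist (s : ℕ → G) : ℕ → G
  | 0 => 1
  | m + 1 => ascProd s (m + 1) * halfTwist s m

variable {s : ℕ → G} {N : ℕ}

theorem ascProd_commute (hc : ∀ i j, i + 2 ≤ j → j < N → Commute (s i) (s j)) {m j : ℕ}
    (h : m + 1 ≤ j) (hj : j < N) : Commute (ascProd s m) (s j) := by
  induction m with
  | zero => exact Commute.one_left _
  | succ m ih => exact (ih (by omega)).mul_left (hc _ _ (by omega) hj)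

theorem descProd_commute (hc : ∀ i j, i + 2 ≤ j → j < N → Commute (s i) (s j)) {m j : ℕ}
    (h : m + 1 ≤ j) (hj : j < N) : Commute (descProd s m) (s j) := by
  induction m with
  | zero => exact Commute.one_left _
  | succ m ih => exact (hc _ _ (by omega) hj).mul_left (ih (by omega))

theorem halfTwist_commute (hc : ∀ i j, i + 2 ≤ j → j < N → Commute (s i) (s j)) {m j : ℕ}
    (h : m + 1 ≤ j) (hj : j < N) : Commute (halfTwist s m) (s j) := by
  induction m with
  | zero => exact Commute.one_left _
  | succ m ih => exact (ascProd_commute hc (by omega) hj).mul_left (ih (by omega))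

/-- On its way from right to left, s_i commutes with every factor of index at least i + 2, becomes
s_{i+1} at the factors s_i s_{i+1} by the braid relation, and then commutes with the remaining
factors of index below i. The relations are only assumed below `N`. -/
theorem ascProd_mul (hb : ∀ i, i + 1 < N → s i * s (i + 1) * s i = s (i + 1) * s i * s (i + 1))
    (hc : ∀ i j, i + 2 ≤ j → j < N → Commute (s i) (s j)) {m i : ℕ} (hi : i + 1 < m) (hm : m ≤ N) :
    ascProd s m * s i = s (i + 1) * ascProd s m := by
  induction m with
  | zero => omega
  | succ m ih =>
    rcases Nat.lt_or_ge (i + 1) m with h | h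
    · have := hc i m (by omega) (by omega)
      rw [ascProd, mul_assoc, ← this.eq, ← mul_assoc, ih h (by omega), mul_assoc]
    · obtain rfl : m = i + 1 := by omega
      have := ascProd_commute hc (le_refl (i + 1)) (by omega : i + 1 < N)
      simp only [ascProd]
      rw [mul_assoc, mul_assoc, ← mul_assoc (s i), hb i (by omega), mul_assoc, ← mul_assoc, this.eq]
      simp only [mul_assoc]

theorem descProd_mul (hb : ∀ i, i + 1 < N → s i * s (i + 1) * s i = s (i + 1) * s i * s (i + 1))
    (hc : ∀ i j, i + 2 ≤ j → j < N → Commute (s i) (s j)) {m i : ℕ} (hi : i + 1 < m) (hm : m ≤ N) :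
    descProd s m * s (i + 1) = s i * descProd s m := by
  induction m with
  | zero => omega
  | succ m ih =>
    rcases Nat.lt_or_ge (i + 1) m with h | h
    · have := hc i m (by omega) (by omega)
      rw [descProd, mul_assoc, ih h (by omega), ← mul_assoc, ← this.eq, mul_assoc]
    · obtain rfl : m = i + 1 := by omega
      have := descProd_commute hc (le_refl (i + 1)) (by omega : i + 1 < N)
      simp only [descProd]
      rw [mul_assoc, mul_assoc, this.eq, ← mul_assoc, ← mul_assoc, ← hb i (by omega)]
      simp only [mul_assoc]

/-- A second factorization of the half twist, with the new product on the right. It is needed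
because `ascProd_mul` does not move the last letter. -/
theorem halfTwist_succ (hc : ∀ i j, i + 2 ≤ j → j < N → Commute (s i) (s j)) {m : ℕ}
    (hm : m + 1 ≤ N) : halfTwist s (m + 1) = halfTwist s m * descProd s (m + 1) := by
  induction m with
  | zero => simp [halfTwist, ascProd, descProd]
  | succ m ih =>
    have := halfTwist_commute hc (le_refl (m + 1)) (by omega : m + 1 < N)
    calc halfTwist s (m + 1 + 1)
        = ascProd s (m + 1) * s (m + 1) * halfTwist s (m + 1) := rfl
      _ = ascProd s (m + 1) * (s (m + 1) * halfTwist s m) * descProd s (m + 1) := by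
          rw [ih (by omega)]; simp only [mul_assoc]
      _ = halfTwist s (m + 1) * descProd s (m + 1 + 1) := by
          rw [← this.eq]; simp only [halfTwist, descProd, mul_assoc]

/-- For i < m the inductive hypothesis acts first and the ascending product then raises the index by
one. For the top letter i = m the descending factorization first lowers the index by one, and the
inductive hypothesis applies to what is left. -/
theorem halfTwist_mul (hb : ∀ i, i + 1 < N → s i * s (i + 1) * s i = s (i + 1) * s i * s (i + 1))
    (hc : ∀ i j, i + 2 ≤ j → j < N → Commute (s i) (s j)) {m i : ℕ} (hi : i < m) (hm : m ≤ N) :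
    halfTwist s m * s i = s (m - 1 - i) * halfTwist s m := by
  induction m generalizing i with
  | zero => omega
  | succ m ih =>
    rcases Nat.lt_or_ge i m with h | h
    · rw [halfTwist, mul_assoc, ih h (by omega), ← mul_assoc,
        ascProd_mul hb hc (by omega) hm, mul_assoc]
      congr 2
      omega
    · obtain rfl : i = m := by omega
      cases i with
      | zero => simp [halfTwist, ascProd]
      | succ j =>
        rw [halfTwist_succ hc hm, mul_assoc, descProd_mul hb hc (by omega) hm, ← mul_assoc,
          ih (by omega) (by omega), mul_assoc]
        congr 2
        omega

end HalfTwist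

theorem exists_conj_sigma_rev (n : ℕ) :
    ∃ D : BraidGroup n, ∀ k : Fin (n - 1), D * sigma k = sigma k.rev * D := by
  -- The relations are only required of the letters below n − 1, so the default value 1 plays no
  -- role.
  let s : ℕ → BraidGroup n := fun i => if h : i < n - 1 then sigma ⟨i, h⟩ else 1
  have hs : ∀ k : Fin (n - 1), s k = sigma k := fun k => dif_pos k.2
  refine ⟨halfTwist s (n - 1), fun k => ?_⟩
  have := halfTwist_mul (s := s) (N := n - 1) ?_ ?_ k.2 le_rfl
  · have e : n - 1 - 1 - (k : ℕ) = k.rev := by rw [Fin.val_rev]; omega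
    rwa [e, hs, hs] at this
  · intro i hi
    have := sigma_braid (n := n) ⟨i, by omega⟩ ⟨i + 1, hi⟩ rfl
    rwa [← hs, ← hs] at this
  · intro i j hij hj
    have := sigma_comm (n := n) ⟨i, by omega⟩ ⟨j, hj⟩ hij
    rwa [← hs, ← hs] at this

theorem braidStar_sigma {n : ℕ} (k : Fin (n - 1)) : braidStar n (sigma k) = (sigma k.rev)⁻¹ :=
  braidLift_sigma _ _ _ k

/-- B ↦ (B^*)⁻¹ and B ↦ D · rev(B) · D⁻¹ are both anti-homomorphisms, and by the choice of D they
agree on generators. The two braids are therefore conjugate, hence transversely equivalent. -/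
theorem transverseClosure_braidStar_inv {n : ℕ} (B : BraidGroup n) :
    transverseClosure (braidStar n B)⁻¹ = (transverseClosure B).mirror := by
  obtain ⟨D, hD⟩ := exists_conj_sigma_rev n
  have key : (braidStar n B)⁻¹ = D * braidRev B * D⁻¹ := by
    rw [eq_mul_inv_iff_mul_eq]
    induction B using braid_induction with
    | one => simp [braidRev]
    | gen k => simp [braidStar_sigma, braidRev_sigma, hD]
    | gen_inv k =>
      rw [map_inv, braidRev_inv, braidStar_sigma, braidRev_sigma, inv_inv, eq_mul_inv_iff_mul_eq,
        mul_assoc, hD, inv_mul_cancel_left]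
    | mul B C hB hC =>
      rw [map_mul, mul_inv_rev, braidRev_mul, mul_assoc, hB, ← mul_assoc, hC, mul_assoc]
  rw [key, transverseClosure_conj]
  rfl

/-- Starring negates the writhe and inversion restores it. Consequently Λ for (B^*)⁻¹ and Λ for B
contain the same unit λμ^{−w}. -/
theorem writhe_braidStar_inv {n : ℕ} (B : BraidGroup n) :
    writhe (braidStar n B)⁻¹ = writhe B := by
  have : (writheHom n).comp (braidStar n) = (writheHom n)⁻¹ := by
    apply braid_hom_ext
    intro k
    simp [braidStar_sigma, writheHom, braidLift_sigma]
  have := congrArg Multiplicative.toAdd (DFunLike.congr_fun this B)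
  simp [writhe] at this ⊢
  omega

theorem lo_rev {n : ℕ} (k : Fin (n - 1)) : lo k.rev = (hi k).rev := by
  ext; simp only [lo, hi, Fin.val_rev]; omega

theorem hi_rev {n : ℕ} (k : Fin (n - 1)) : hi k.rev = (lo k).rev := by
  ext; simp only [lo, hi, Fin.val_rev]; omega

theorem permHom_sigma {n : ℕ} (k : Fin (n - 1)) :
    permHom n (sigma k) = Equiv.swap (lo k) (hi k) :=
  braidLift_sigma _ _ _ k

/-- A transposition is its own inverse, so on permutations starring is only the relabelling of
strands by reversal. The cycle structure, and with it being a knot, is preserved. -/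
theorem permHom_braidStar {n : ℕ} (B : BraidGroup n) :
    permHom n (braidStar n B) = Fin.revPerm * permHom n B * Fin.revPerm⁻¹ := by
  have : (permHom n).comp (braidStar n) = (MulAut.conj Fin.revPerm).toMonoidHom.comp (permHom n) := by
    apply braid_hom_ext
    intro k
    simp only [MonoidHom.comp_apply, braidStar_sigma, map_inv, permHom_sigma, Equiv.swap_inv,
      MulEquiv.toMonoidHom_eq_coe, MonoidHom.coe_coe, MulAut.conj_apply]
    rw [← Equiv.swap_apply_apply, lo_rev, hi_rev, Equiv.swap_comm]
    rfl
  simpa using DFunLike.congr_fun this B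

theorem ClosureIsKnot.sameCycle {n : ℕ} {B : BraidGroup n} (hB : ClosureIsKnot B) (i j : Fin n) :
    (permHom n B).SameCycle i j := by
  have := (Nat.card_eq_one_iff_unique.mp hB).1
  exact Quotient.exact (s := Equiv.Perm.SameCycle.setoid (permHom n B))
    (Subsingleton.elim (Quotient.mk _ i) (Quotient.mk _ j))

/-- A unit-valued cochain on a cycle with prescribed coboundary concentrated at two points. -/
theorem exists_cochain {I M : Type*} [Finite I] [DecidableEq I] [CommGroup M] (p : Equiv.Perm I)
    {a b : I} (h : p.SameCycle a b) (u : M) :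
    ∃ k : I → M, ∀ i, k (p i) = k i * ((if i = a then u else 1) * (if i = b then u else 1)⁻¹) := by
  obtain ⟨m, rfl⟩ := h.exists_nat_pow_eq
  clear h
  induction m with
  | zero => exact ⟨1, fun i => by simp⟩
  | succ m ih =>
    obtain ⟨k, hk⟩ := ih
    -- Moving the second point one step along the cycle changes k by u at the single point p^{m+1}
    -- a. The coboundary of this factor is u at p^m a times u⁻¹ at p^{m+1} a, so the contributions
    -- at p^m a cancel.
    refine ⟨fun i => k i * (if i = (p ^ (m + 1)) a then u else 1), fun i => ?_⟩
    have e : p i = (p ^ (m + 1)) a ↔ i = (p ^ m) a := by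
      rw [pow_succ', Equiv.Perm.mul_apply, p.apply_eq_iff_eq]
    simp only [hk, e]
    split_ifs <;> simp_all

/-! ## Degrees, signs and the opposite of a derivation on a free algebra -/

section FreeGraded

variable {S : Type*} [CommRing S] {X : Type*} {deg : X → ℕ}

theorem wordProd_cons (x : X) (w : List X) :
    wordProd S (x :: w) = FreeAlgebra.ι S x * wordProd S w := by
  simp [wordProd]

theorem wordProd_append (v w : List X) : wordProd S (v ++ w) = wordProd S v * wordProd S w := by
  simp [wordProd]

theorem wordProd_singleton (x : X) : wordProd S [x] = FreeAlgebra.ι S x := by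
  simp [wordProd]

theorem wordProd_mem_degreePart (w : List X) :
    wordProd S w ∈ degreePart S deg (w.map deg).sum :=
  Submodule.subset_span ⟨w, rfl, rfl⟩

theorem mul_mem_degreePart {j k : ℕ} {x y : FreeAlgebra S X} (hx : x ∈ degreePart S deg j)
    (hy : y ∈ degreePart S deg k) : x * y ∈ degreePart S deg (j + k) := by
  have := Submodule.mul_mem_mul hx hy
  rw [degreePart, degreePart, Submodule.span_mul_span] at this
  refine Submodule.span_mono ?_ this
  rintro _ ⟨_, ⟨v, hv, rfl⟩, _, ⟨w, hw, rfl⟩, rfl⟩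
  exact ⟨v ++ w, by simp [hv, hw], (wordProd_append v w).symm⟩

theorem ι_mem_degreePart (x : X) : FreeAlgebra.ι S x ∈ degreePart S deg (deg x) :=
  Submodule.subset_span ⟨[x], by simp, (wordProd_singleton x).symm⟩

theorem one_mem_degreePart : (1 : FreeAlgebra S X) ∈ degreePart S deg 0 :=
  Submodule.subset_span ⟨[], by simp, by simp [wordProd]⟩

theorem algebraMap_mem_degreePart (r : S) :
    algebraMap S (FreeAlgebra S X) r ∈ degreePart S deg 0 := by
  rw [Algebra.algebraMap_eq_smul_one]
  exact Submodule.smul_mem _ _ one_mem_degreePart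

theorem linearMap_ext_wordProd {M : Type*} [AddCommMonoid M] [Module S M]
    {f g : FreeAlgebra S X →ₗ[S] M} (h : ∀ w, f (wordProd S w) = g (wordProd S w)) : f = g := by
  apply (FreeAlgebra.basisFreeMonoid S X).ext
  intro w
  rw [basisFreeMonoid_eq]
  exact h _

theorem opExponent_append (v w : List X) :
    opExponent deg (v ++ w) =
      opExponent deg v + opExponent deg w + (v.map deg).sum * (w.map deg).sum := by
  induction v with
  | nil => simp [opExponent]
  | cons x v ih => simp [opExponent, ih]; ring

theorem opExponent_reverse (w : List X) : opExponent deg w.reverse = opExponent deg w := by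
  induction w with
  | nil => rfl
  | cons x w ih =>
    rw [List.reverse_cons, opExponent_append, ih]
    simp [opExponent]
    ring

theorem opExponent_eq_zero {w : List X} (h : (w.map deg).sum ≤ 1) : opExponent deg w = 0 := by
  induction w with
  | nil => rfl
  | cons x w ih =>
    simp only [List.map_cons, List.sum_cons] at h
    rw [opExponent, ih (by omega)]
    have : deg x = 0 ∨ (w.map deg).sum = 0 := by omega
    rcases this with h | h <;> simp [h]

theorem opMap_opMap (x : FreeAlgebra S X) : opMap S deg (opMap S deg x) = x := by
  have : opMap S deg ∘ₗ opMap S deg = LinearMap.id := by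
    apply linearMap_ext_wordProd
    intro w
    simp only [LinearMap.comp_apply, opMap_wordProd, map_smul, LinearMap.id_apply,
      opExponent_reverse, List.reverse_reverse, smul_smul, ← mul_pow]
    simp
  exact DFunLike.congr_fun this x

/-- The sign exponent of a concatenation exceeds the sum of the two exponents by the pairs with one
letter in each factor, which contribute the product of the total degrees. -/
theorem opMap_mul {j k : ℕ} {x y : FreeAlgebra S X} (hx : x ∈ degreePart S deg j)
    (hy : y ∈ degreePart S deg k) :
    opMap S deg (x * y) = (-1 : S) ^ (j * k) • (opMap S deg y * opMap S deg x) := by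
  induction hx using Submodule.span_induction with
  | zero => simp
  | add a b _ _ ha hb => rw [add_mul, map_add, ha, hb, map_add, mul_add, smul_add]
  | smul r a _ ha => rw [smul_mul_assoc, map_smul, ha, map_smul, mul_smul_comm, smul_comm]
  | mem x hx =>
    obtain ⟨v, rfl, rfl⟩ := hx
    induction hy using Submodule.span_induction with
    | zero => simp
    | add a b _ _ ha hb => rw [mul_add, map_add, ha, hb, map_add, add_mul, smul_add]
    | smul r a _ ha => rw [mul_smul_comm, map_smul, ha, map_smul, smul_mul_assoc, smul_comm]
    | mem y hy =>
      obtain ⟨w, rfl, rfl⟩ := hy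
      rw [← wordProd_append, opMap_wordProd, opMap_wordProd, opMap_wordProd, opExponent_append,
        List.reverse_append, wordProd_append, smul_mul_smul_comm, smul_smul, ← pow_add, ← pow_add]
      congr 2
      ring

theorem opMap_ι (x : X) : opMap S deg (FreeAlgebra.ι S x) = FreeAlgebra.ι S x := by
  rw [← wordProd_singleton, opMap_wordProd]
  simp [opExponent]

theorem star_wordProd (w : List X) : star (wordProd S w) = wordProd S w.reverse := by
  induction w with
  | nil => simp [wordProd]
  | cons x w ih =>
    rw [wordProd_cons, star_mul, ih, List.reverse_cons, wordProd_append, wordProd_singleton,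
      FreeAlgebra.star_ι]

theorem star_smul_freeAlgebra (r : S) (x : FreeAlgebra S X) : star (r • x) = r • star x := by
  rw [Algebra.smul_def, star_mul, FreeAlgebra.star_algebraMap, Algebra.smul_def, Algebra.commutes]

/-- In total degree at most 1 no two letters both have positive degree, so every sign is trivial.
The values of ∂^- on generators lie in this range, and for them `op` may be replaced by `star`, an
honest ring anti-automorphism. -/
theorem opMap_eq_star {k : ℕ} {x : FreeAlgebra S X} (hx : x ∈ degreePart S deg k) (hk : k ≤ 1) :
    opMap S deg x = star x := by
  induction hx using Submodule.span_induction with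
  | zero => simp
  | add a b _ _ ha hb => rw [map_add, ha, hb, star_add]
  | smul r a _ ha => rw [map_smul, ha, star_smul_freeAlgebra]
  | mem x hx =>
    obtain ⟨w, rfl, rfl⟩ := hx
    rw [opMap_wordProd, opExponent_eq_zero hk, star_wordProd, pow_zero, one_smul]

theorem signHom_of_mem {k : ℕ} {x : FreeAlgebra S X} (hx : x ∈ degreePart S deg k) :
    signHom S deg x = (-1 : S) ^ k • x := by
  induction hx using Submodule.span_induction with
  | zero => simp
  | add a b _ _ ha hb => rw [map_add, ha, hb, smul_add]
  | smul r a _ ha => rw [map_smul, ha, smul_comm]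
  | mem x hx =>
    obtain ⟨w, rfl, rfl⟩ := hx
    induction w with
    | nil => simp [wordProd]
    | cons x w ih =>
      rw [wordProd_cons, map_mul, ih, signHom, FreeAlgebra.lift_ι_apply]
      simp only [List.map_cons, List.sum_cons, pow_add, mul_smul_comm, mul_smul]
      rw [smul_comm]
      congr 1
      rw [mul_assoc, Algebra.smul_def]
      simp

theorem opMap_mem_degreePart {k : ℕ} {x : FreeAlgebra S X} (hx : x ∈ degreePart S deg k) :
    opMap S deg x ∈ degreePart S deg k := by
  induction hx using Submodule.span_induction with
  | zero => simp
  | add a b _ _ ha hb => rw [map_add]; exact add_mem ha hb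
  | smul r a _ ha => rw [map_smul]; exact Submodule.smul_mem _ _ ha
  | mem x hx =>
    obtain ⟨w, rfl, rfl⟩ := hx
    rw [opMap_wordProd]
    refine Submodule.smul_mem _ _ (Submodule.subset_span ⟨_, ?_, rfl⟩)
    rw [List.map_reverse, List.sum_reverse]

variable {D : X → FreeAlgebra S X}

/-- Degrees are natural numbers, so there is no part of degree −1; the behaviour of a derivation of
degree −1 on degree 0 has to be recorded as vanishing. -/
theorem diffOf_degreePart_zero (h0 : ∀ x, deg x = 0 → D x = 0) {x : FreeAlgebra S X}
    (hx : x ∈ degreePart S deg 0) : diffOf deg D x = 0 := by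
  induction hx using Submodule.span_induction with
  | zero => simp
  | add a b _ _ ha hb => rw [map_add, ha, hb, add_zero]
  | smul r a _ ha => rw [map_smul, ha, smul_zero]
  | mem x hx =>
    obtain ⟨w, hw, rfl⟩ := hx
    induction w with
    | nil => simpa [wordProd] using diffOf_algebraMap deg D (1 : S)
    | cons x w ih =>
      simp only [List.map_cons, List.sum_cons, add_eq_zero] at hw
      rw [wordProd_cons, diffOf_mul, diffOf_ι, h0 x hw.1, ih hw.2]
      simp

theorem diffOf_mem_degreePart (h0 : ∀ x, deg x = 0 → D x = 0)
    (h1 : ∀ x k, deg x = k + 1 → D x ∈ degreePart S deg k) {k : ℕ} {x : FreeAlgebra S X}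
    (hx : x ∈ degreePart S deg (k + 1)) : diffOf deg D x ∈ degreePart S deg k := by
  induction hx using Submodule.span_induction with
  | zero => simp
  | add a b _ _ ha hb => rw [map_add]; exact add_mem ha hb
  | smul r a _ ha => rw [map_smul]; exact Submodule.smul_mem _ _ ha
  | mem x hx =>
    obtain ⟨w, hw, rfl⟩ := hx
    induction w generalizing k with
    | nil => simp at hw
    | cons x w ih =>
      simp only [List.map_cons, List.sum_cons] at hw
      rw [wordProd_cons, diffOf_mul, diffOf_ι, signHom_of_mem (ι_mem_degreePart x)]
      refine add_mem ?_ ?_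
      · cases hx : deg x with
        | zero => rw [h0 x hx, zero_mul]; exact zero_mem _
        | succ j =>
          obtain rfl : k = j + (w.map deg).sum := by omega
          exact mul_mem_degreePart (h1 x j hx) (wordProd_mem_degreePart w)
      · rw [smul_mul_assoc]
        refine Submodule.smul_mem _ _ ?_
        cases hs : (w.map deg).sum with
        | zero =>
          rw [diffOf_degreePart_zero h0 (hs ▸ wordProd_mem_degreePart w), mul_zero]
          exact zero_mem _
        | succ j =>
          obtain rfl : k = deg x + j := by omega
          exact mul_mem_degreePart (ι_mem_degreePart x) (ih hs)

/-- Conjugating a derivation by `op` gives the derivation with the opposite values on the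
generators. -/
theorem opMap_diffOf_opMap (h0 : ∀ x, deg x = 0 → D x = 0)
    (h1 : ∀ x k, deg x = k + 1 → D x ∈ degreePart S deg k) :
    opMap S deg ∘ₗ diffOf deg D ∘ₗ opMap S deg = diffOf deg (fun x => opMap S deg (D x)) := by
  set E := diffOf deg (fun x => opMap S deg (D x)) with hE
  have e0 : ∀ x, deg x = 0 → opMap S deg (D x) = 0 := fun x hx => by rw [h0 x hx, map_zero]
  have e1 : ∀ x k, deg x = k + 1 → opMap S deg (D x) ∈ degreePart S deg k :=
    fun x k hx => opMap_mem_degreePart (h1 x k hx)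
  -- Since `op` is an involution, the claim is equivalent to one with a single `op` on each side,
  -- which can be proved by induction on the length of a word.
  have key : diffOf deg D ∘ₗ opMap S deg = opMap S deg ∘ₗ E := by
    apply linearMap_ext_wordProd
    intro w
    simp only [LinearMap.comp_apply]
    induction w with
    | nil =>
      have h1 : wordProd S ([] : List X) = algebraMap S _ 1 := by simp [wordProd]
      have h2 := opMap_wordProd S deg ([] : List X)
      rw [List.reverse_nil, opExponent, pow_zero, one_smul] at h2
      rw [h2, h1, hE, diffOf_algebraMap, diffOf_algebraMap, map_zero]
    | cons x w ih =>
      have hx : FreeAlgebra.ι S x ∈ degreePart S deg (deg x) := ι_mem_degreePart x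
      have hw : wordProd S w ∈ degreePart S deg (w.map deg).sum := wordProd_mem_degreePart w
      have hL : diffOf deg D (opMap S deg (wordProd S (x :: w))) =
          (-1 : S) ^ (deg x * (w.map deg).sum) •
            (opMap S deg (E (wordProd S w)) * FreeAlgebra.ι S x +
              (-1 : S) ^ (w.map deg).sum • (opMap S deg (wordProd S w) * D x)) := by
        rw [wordProd_cons, opMap_mul hx hw, map_smul, diffOf_mul, ih, opMap_ι, diffOf_ι,
          signHom_of_mem (opMap_mem_degreePart hw), smul_mul_assoc]
      have hR : E (wordProd S (x :: w)) = opMap S deg (D x) * wordProd S w +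
          (-1 : S) ^ deg x • (FreeAlgebra.ι S x * E (wordProd S w)) := by
        rw [wordProd_cons, hE, diffOf_mul, diffOf_ι, signHom_of_mem hx, smul_mul_assoc]
      rw [hL, hR, map_add, map_smul, smul_add, add_comm]
      congr 1
      -- For |x| = j + 1 the two signs have exponents (j + 1)|w| + |w| and j|w|, which have the same
      -- parity. For |x| = 0 the term vanishes.
      · cases hd : deg x with
        | zero => rw [h0 x hd]; simp
        | succ j =>
          rw [opMap_mul (e1 x j hd) hw, opMap_opMap, smul_smul, ← pow_add]
          congr 1
          rw [add_one_mul, add_assoc, ← two_mul, pow_add, pow_mul (-1 : S) 2]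
          simp
      · cases hs : (w.map deg).sum with
        | zero =>
          rw [hE, diffOf_degreePart_zero e0 (hs ▸ hw)]; simp
        | succ j =>
          rw [opMap_mul hx (diffOf_mem_degreePart e0 e1 (hs ▸ hw)), opMap_ι, smul_smul, ← pow_add]
          congr 1
          rw [mul_add_one, add_comm]
  rw [key]
  ext x
  simp only [LinearMap.comp_apply, opMap_opMap]

/-- An algebra homomorphism of free algebras compatible with degrees intertwines two derivations
as soon as it does so on the generators. -/
theorem map_diffOf_of_generators {Y : Type*} {deg' : Y → ℕ} {D' : Y → FreeAlgebra S Y}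
    (f : FreeAlgebra S X →ₐ[S] FreeAlgebra S Y)
    (hdeg : ∀ x, f (FreeAlgebra.ι S x) ∈ degreePart S deg' (deg x))
    (h : ∀ x, f (D x) = diffOf deg' D' (f (FreeAlgebra.ι S x))) (y : FreeAlgebra S X) :
    f (diffOf deg D y) = diffOf deg' D' (f y) := by
  have hs : f.comp (signHom S deg) = (signHom S deg').comp f := by
    apply FreeAlgebra.hom_ext
    funext x
    simp only [Function.comp_apply, AlgHom.comp_apply]
    rw [signHom_of_mem (hdeg x), signHom_of_mem (ι_mem_degreePart x), map_smul]
  induction y using FreeAlgebra.induction with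
  | grade0 r => rw [diffOf_algebraMap, AlgHom.commutes, diffOf_algebraMap, map_zero]
  | grade1 x => rw [diffOf_ι, h]
  | mul a b ha hb =>
    rw [diffOf_mul, map_add, map_mul, map_mul, ha, hb, map_mul, diffOf_mul]
    congr 2
    exact DFunLike.congr_fun hs a
  | add a b ha hb => simp only [map_add, ha, hb]

theorem map_mem_degreePart {Y : Type*} {deg' : Y → ℕ} (f : FreeAlgebra S X →ₐ[S] FreeAlgebra S Y)
    (hdeg : ∀ x, f (FreeAlgebra.ι S x) ∈ degreePart S deg' (deg x)) {k : ℕ}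
    {y : FreeAlgebra S X} (hy : y ∈ degreePart S deg k) : f y ∈ degreePart S deg' k := by
  induction hy using Submodule.span_induction with
  | zero => simp
  | add a b _ _ ha hb => rw [map_add]; exact add_mem ha hb
  | smul r a _ ha => rw [map_smul]; exact Submodule.smul_mem _ _ ha
  | mem y hy =>
    obtain ⟨w, rfl, rfl⟩ := hy
    induction w with
    | nil => simpa [wordProd] using one_mem_degreePart
    | cons x w ih =>
      rw [wordProd_cons, map_mul]
      exact mul_mem_degreePart (hdeg x) ih

end FreeGraded

/-! ## Symmetries of the braid group action -/

section Flip

variable {S : Type*} [CommRing S] {I : Type*} [DecidableEq I]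

theorem matA_self (i : I) : matA S I i i = -2 := by simp [matA]

variable (S) in
/-- The anti-automorphism `a_{ij} ↦ a_{r j, r i}`, as a homomorphism to the opposite algebra. -/
def flipHom (r : Equiv.Perm I) : AAlg S I →ₐ[S] (AAlg S I)ᵐᵒᵖ :=
  FreeAlgebra.lift S (fun x => MulOpposite.op (matA S I (r x.1.2) (r x.1.1)))

/-- The anti-automorphism `a_{ij} ↦ a_{r j, r i}`. -/
def flipA (r : Equiv.Perm I) (x : AAlg S I) : AAlg S I := (flipHom S r x).unop

theorem flipA_mul (r : Equiv.Perm I) (x y : AAlg S I) :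
    flipA r (x * y) = flipA r y * flipA r x := by simp [flipA]

theorem flipA_sum (r : Equiv.Perm I) {J : Type*} (s : Finset J) (f : J → AAlg S I) :
    flipA r (∑ j ∈ s, f j) = ∑ j ∈ s, flipA r (f j) := by
  rw [flipA, map_sum]
  exact map_sum MulOpposite.opAddEquiv.symm _ _

theorem flipHom_matA (r : Equiv.Perm I) (i j : I) :
    flipHom S r (matA S I i j) = MulOpposite.op (matA S I (r j) (r i)) := by
  by_cases h : i = j
  · subst h
    rw [matA_self, matA_self, map_neg, map_ofNat]
    rfl
  · conv_lhs => rw [matA, dif_pos h]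
    simp [flipHom]

theorem flipA_matA (r : Equiv.Perm I) (i j : I) :
    flipA r (matA S I i j) = matA S I (r j) (r i) := by
  rw [flipA, flipHom_matA, MulOpposite.unop_op]

/-- The formulas for φ_{σ_k} on a_{ki} and on a_{ik} are exchanged by swapping the two indices and
reversing products; the permutation `r` merely renames strands. -/
theorem phiHom_flipA (r : Equiv.Perm I) (p q : I) (x : AAlg S I) :
    phiHom S (r p) (r q) (flipA r x) = flipA r (phiHom S p q x) := by
  have : (AlgHom.op (phiHom S (r p) (r q))).comp (flipHom S r) =
      (flipHom S r).comp (phiHom S p q) := by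
    apply AAlg_hom_ext
    intro i j hij
    have hji : r j ≠ r i := fun h => hij (r.injective h).symm
    simp only [AlgHom.comp_apply, flipHom_matA]
    apply MulOpposite.unop_injective
    rw [AlgHom.op_apply_apply, MulOpposite.unop_op, MulOpposite.unop_op, phiHom_matA _ _ _ _ _ hij,
      phiHom_matA _ _ _ _ _ hji]
    simp only [r.apply_eq_iff_eq]
    by_cases h1 : i = p <;> by_cases h2 : i = q <;> by_cases h3 : j = p <;>
      by_cases h4 : j = q <;> simp_all [flipHom_matA]
  exact congrArg MulOpposite.unop (DFunLike.congr_fun this x)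

/-- This symmetry is why inverting a generator, as B ↦ B^* does, can be compensated by reversing the
order of the strands. -/
theorem phiHomInv_eq (p q : I) : phiHomInv S p q = phiHom S q p := by
  apply AAlg_hom_ext
  intro i j hij
  rw [phiHomInv_matA _ _ _ _ _ hij, phiHom_matA _ _ _ _ _ hij]

/-- Two actions are allowed so that one induction serves both φ on n strands and its extension to n
+ 1 strands. -/
theorem flipA_intertwines {n : ℕ} {f g : BraidGroup n →* (AAlg S I ≃ₐ[S] AAlg S I)}
    (r : Equiv.Perm I) (h : ∀ k x, f (sigma k) (flipA r x) = flipA r (g (sigma k) x))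
    (B : BraidGroup n) (x : AAlg S I) : f B (flipA r x) = flipA r (g B x) := by
  revert x
  induction B using braid_induction with
  | one => intro x; simp
  | gen k => exact h k
  | gen_inv k =>
    intro x
    have := h k (g (sigma k)⁻¹ x)
    rw [← AlgEquiv.mul_apply, ← map_mul, mul_inv_cancel, map_one, AlgEquiv.one_apply] at this
    rw [← this, ← AlgEquiv.mul_apply, ← map_mul, inv_mul_cancel, map_one, AlgEquiv.one_apply]
  | mul B C hB hC =>
    intro x
    rw [map_mul, map_mul, AlgEquiv.mul_apply, AlgEquiv.mul_apply, hC, hB]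

end Flip

/-! ### Reflection exchanges Φ^L_B and Φ^R_{B^*} -/

section FlipStar

variable {S : Type*} [CommRing S] {n : ℕ}

theorem phi_sigma_apply (k : Fin (n - 1)) (x : AAlg S (Fin n)) :
    phi S n (sigma k) x = phiHom S (lo k) (hi k) x := by
  rw [phi_sigma]; rfl

/-- Strand reversal sends the pair (k, k + 1) of σ_k to the pair crossed by σ_{n−k}, in the opposite
order. By `phiHomInv_eq` the opposite order amounts to inversion, so σ_k is carried to σ_k^*. -/
theorem phi_braidStar_flipA (B : BraidGroup n) (x : AAlg S (Fin n)) :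
    phi S n (braidStar n B) (flipA Fin.revPerm x) = flipA Fin.revPerm (phi S n B x) := by
  refine flipA_intertwines (f := (phi S n).comp (braidStar n)) _ (fun k x => ?_) B x
  rw [MonoidHom.comp_apply, braidStar_sigma, phi_sigma_inv_apply, phiHomInv_eq, phi_sigma_apply,
    hi_rev, lo_rev, ← phiHom_flipA]
  rfl

/-- Reversal of the first `n` of `n + 1` strands. -/
def revFix (n : ℕ) : Equiv.Perm (Fin (n + 1)) :=
  finSuccEquivLast.trans ((Equiv.optionCongr Fin.revPerm).trans finSuccEquivLast.symm)

theorem revFix_castSucc (i : Fin n) : revFix n i.castSucc = i.rev.castSucc := by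
  simp [revFix]

theorem revFix_last : revFix n (Fin.last n) = Fin.last n := by
  simp [revFix]

theorem phi_addStrand_braidStar_flipA (B : BraidGroup n) (x : AAlg S (Fin (n + 1))) :
    phi S (n + 1) (addStrand n (braidStar n B)) (flipA (revFix n) x) =
      flipA (revFix n) (phi S (n + 1) (addStrand n B) x) := by
  refine flipA_intertwines (f := ((phi S (n + 1)).comp (addStrand n)).comp (braidStar n))
    (g := (phi S (n + 1)).comp (addStrand n)) _ (fun k x => ?_) B x
  rw [MonoidHom.comp_apply, MonoidHom.comp_apply, MonoidHom.comp_apply, braidStar_sigma, map_inv,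
    addStrand_sigma, addStrand_sigma, phi_sigma_inv_apply, phiHomInv_eq, phi_sigma_apply,
    hi_idxIncl, lo_idxIncl, hi_idxIncl, lo_idxIncl, hi_rev, lo_rev, ← revFix_castSucc,
    ← revFix_castSucc, phiHom_flipA]

theorem inclA_flipA (x : AAlg S (Fin n)) :
    inclA S n (flipA Fin.revPerm x) = flipA (revFix n) (inclA S n x) := by
  have : (AlgHom.op (inclA S n)).comp (flipHom S Fin.revPerm) =
      (flipHom S (revFix n)).comp (inclA S n) := by
    apply AAlg_hom_ext
    intro i j _
    simp only [AlgHom.comp_apply, flipHom_matA, inclA_matA, revFix_castSucc]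
    apply MulOpposite.unop_injective
    simp [inclA_matA]
  exact congrArg MulOpposite.unop (DFunLike.congr_fun this x)

/-- Reflection of a matrix in the antidiagonal, combined with the anti-automorphism
`a_{ij} ↦ a_{n+1-j,n+1-i}` of the coefficients. -/
def reflectA (M : Matrix (Fin n) (Fin n) (AAlg S (Fin n))) : Matrix (Fin n) (Fin n) (AAlg S (Fin n)) :=
  fun i j => flipA Fin.revPerm (M j.rev i.rev)

/-- Reversing the first n strands while fixing the extra one exchanges the column a_{i,n+1} with the
row a_{n+1,i}. The flipped defining equation of Φ^L_B is therefore that of Φ^R_{B^*}, and uniqueness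
concludes. -/
theorem PhiR_braidStar (B : BraidGroup n) : PhiR S (braidStar n B) = reflectA (PhiL S B) := by
  refine IsPhiR.unique (isPhiR_PhiR _) (fun i => ?_)
  have h := congrArg (flipA (revFix n)) (isPhiL_PhiL (S := S) B i.rev)
  rw [← phi_addStrand_braidStar_flipA, flipA_matA, revFix_last, revFix_castSucc, Fin.rev_rev,
    flipA_sum] at h
  rw [h, ← Equiv.sum_comp Fin.revPerm]
  refine Finset.sum_congr rfl (fun l _ => ?_)
  rw [flipA_mul, flipA_matA, revFix_last, revFix_castSucc, reflectA, inclA_flipA]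
  simp

theorem PhiL_braidStar (B : BraidGroup n) : PhiL S (braidStar n B) = reflectA (PhiR S B) := by
  refine IsPhiL.unique (isPhiL_PhiL _) (fun i => ?_)
  have h := congrArg (flipA (revFix n)) (isPhiR_PhiR (S := S) B i.rev)
  rw [← phi_addStrand_braidStar_flipA, flipA_matA, revFix_last, revFix_castSucc, Fin.rev_rev,
    flipA_sum] at h
  rw [h, ← Equiv.sum_comp Fin.revPerm]
  refine Finset.sum_congr rfl (fun l _ => ?_)
  rw [flipA_mul, flipA_matA, revFix_last, revFix_castSucc, reflectA, inclA_flipA]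
  simp

theorem phi_braidStar_matA (B : BraidGroup n) :
    (matA S (Fin n)).map (phi S n (braidStar n B)) = reflectA ((matA S (Fin n)).map (phi S n B)) := by
  ext i j
  rw [reflectA, Matrix.map_apply, Matrix.map_apply, ← phi_braidStar_flipA, flipA_matA]
  simp

end FlipStar

/-! ## Rescaling the generators -/

section Gauge

variable {S : Type*} [CommRing S] {I : Type*} [DecidableEq I]

variable (S) in
/-- The rescaling `a_{ij} ↦ κ_i κ_j⁻¹ a_{ij}`. -/
def gauge (κ : I → Sˣ) : AAlg S I →ₐ[S] AAlg S I :=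
  FreeAlgebra.lift S (fun x => ((κ x.1.1 * (κ x.1.2)⁻¹ : Sˣ) : S) • FreeAlgebra.ι S x)

theorem gauge_matA (κ : I → Sˣ) (i j : I) :
    gauge S κ (matA S I i j) = ((κ i * (κ j)⁻¹ : Sˣ) : S) • matA S I i j := by
  by_cases h : i = j
  · subst h
    rw [matA_self, map_neg, map_ofNat]
    simp
  · conv_lhs => rw [matA, dif_pos h]
    simp [gauge, matA, h]

theorem gauge_gauge (κ κ' : I → Sˣ) (x : AAlg S I) :
    gauge S κ (gauge S κ' x) = gauge S (κ' * κ) x := by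
  have : (gauge S κ).comp (gauge S κ') = gauge S (κ' * κ) := by
    apply AAlg_hom_ext
    intro i j _
    rw [AlgHom.comp_apply, gauge_matA, map_smul, gauge_matA, gauge_matA, smul_smul]
    congr 1
    push_cast [Pi.mul_apply, mul_inv]
    ring
  exact DFunLike.congr_fun this x

theorem gauge_one (x : AAlg S I) : gauge S 1 x = x := by
  have : gauge S (1 : I → Sˣ) = AlgHom.id S _ := by
    apply AAlg_hom_ext
    intro i j _
    simp [gauge_matA]
  exact DFunLike.congr_fun this x

/-- The rescaling `a_{ij} ↦ κ_i κ_j⁻¹ a_{ij}` as an automorphism. -/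
def gaugeEquiv (κ : I → Sˣ) : AAlg S I ≃ₐ[S] AAlg S I :=
  AlgEquiv.ofAlgHom (gauge S κ) (gauge S κ⁻¹)
    (by ext1; funext x; simp only [Function.comp_apply, AlgHom.comp_apply, gauge_gauge]; simp [gauge_one])
    (by ext1; funext x; simp only [Function.comp_apply, AlgHom.comp_apply, gauge_gauge]; simp [gauge_one])

/-- Read a word a_{i l}a_{l m}⋯ as a path of strands. Each word in φ_{σ_k}(a_{ij}) is a path from
π(i) to π(j), where π is the transposition of k and k + 1; along a path the weights telescope to
κ_{π(i)}κ_{π(j)}⁻¹. -/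
theorem gauge_phiHom (κ : I → Sˣ) (p q : I) (x : AAlg S I) :
    gauge S κ (phiHom S p q x) = phiHom S p q (gauge S (κ ∘ Equiv.swap p q) x) := by
  have : (gauge S κ).comp (phiHom S p q) =
      (phiHom S p q).comp (gauge S (κ ∘ Equiv.swap p q)) := by
    apply AAlg_hom_ext
    intro i j hij
    simp only [AlgHom.comp_apply, gauge_matA, map_smul]
    rw [phiHom_matA _ _ _ _ _ hij]
    by_cases h1 : i = p <;> by_cases h2 : i = q <;> by_cases h3 : j = p <;>
      by_cases h4 : j = q <;> simp_all [gauge_matA, Equiv.swap_apply_of_ne_of_ne, smul_smul,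
        smul_sub, mul_assoc, mul_comm, mul_left_comm]
    all_goals rw [mul_left_comm, Units.mul_inv_cancel_left]
  exact DFunLike.congr_fun this x

/-- The map `e` extends weights on n strands to the index set acted on, so that the same induction
also covers the action with an added strand. -/
theorem gauge_intertwines {n : ℕ} {J : Type*} {f : BraidGroup n →* (AAlg S J ≃ₐ[S] AAlg S J)}
    (e : (Fin n → Sˣ) → (J → Sˣ))
    (h : ∀ k κ x, gauge S (e κ) (f (sigma k) x) =
      f (sigma k) (gauge S (e (κ ∘ permHom n (sigma k))) x))
    (B : BraidGroup n) (κ : Fin n → Sˣ) (x : AAlg S J) :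
    gauge S (e κ) (f B x) = f B (gauge S (e (κ ∘ permHom n B)) x) := by
  revert κ x
  induction B using braid_induction with
  | one => intro κ x; simp
  | gen k => exact h k
  | gen_inv k =>
    intro κ x
    have := h k (κ ∘ permHom n (sigma k)⁻¹) (f (sigma k)⁻¹ x)
    rw [← AlgEquiv.mul_apply, ← map_mul, mul_inv_cancel, map_one, AlgEquiv.one_apply] at this
    rw [this, ← AlgEquiv.mul_apply, ← map_mul, inv_mul_cancel, map_one, AlgEquiv.one_apply,
      Function.comp_assoc, ← Equiv.Perm.coe_mul, ← map_mul, inv_mul_cancel, map_one]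
    simp
  | mul B C hB hC =>
    intro κ x
    rw [map_mul, AlgEquiv.mul_apply, hB, hC, AlgEquiv.mul_apply, map_mul, Equiv.Perm.coe_mul,
      Function.comp_assoc]

end Gauge

/-! ### Weights and invertibility of Φ^L and Φ^R -/

section GaugePhi

variable {S : Type*} [CommRing S] {n : ℕ}

theorem gauge_phi (κ : Fin n → Sˣ) (B : BraidGroup n) (x : AAlg S (Fin n)) :
    gauge S κ (phi S n B x) = phi S n B (gauge S (κ ∘ permHom n B) x) := by
  refine gauge_intertwines id (fun k κ x => ?_) B κ x
  rw [phi_sigma_apply, phi_sigma_apply, permHom_sigma]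
  exact gauge_phiHom κ _ _ x

/-- Extension of a family of units by `1`. -/
def extendOne (κ : Fin n → Sˣ) : Fin (n + 1) → Sˣ := Fin.snoc (α := fun _ => Sˣ) κ 1

theorem extendOne_castSucc (κ : Fin n → Sˣ) (i : Fin n) : extendOne κ i.castSucc = κ i := by
  simp [extendOne]

theorem extendOne_last (κ : Fin n → Sˣ) : extendOne κ (Fin.last n) = 1 := by
  simp [extendOne]

theorem extendOne_comp_swap (κ : Fin n → Sˣ) (p q : Fin n) :
    extendOne κ ∘ Equiv.swap p.castSucc q.castSucc = extendOne (κ ∘ Equiv.swap p q) := by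
  funext i
  refine Fin.lastCases ?_ (fun i => ?_) i
  · rw [Function.comp_apply, Equiv.swap_apply_of_ne_of_ne (Fin.castSucc_lt_last _).ne'
      (Fin.castSucc_lt_last _).ne', extendOne_last, extendOne_last]
  · rw [Function.comp_apply, extendOne_castSucc, Function.comp_apply,
      (Fin.castSucc_injective n).swap_apply, extendOne_castSucc]

theorem gauge_phi_addStrand (κ : Fin n → Sˣ) (B : BraidGroup n) (x : AAlg S (Fin (n + 1))) :
    gauge S (extendOne κ) (phi S (n + 1) (addStrand n B) x) =
      phi S (n + 1) (addStrand n B) (gauge S (extendOne (κ ∘ permHom n B)) x) := by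
  refine gauge_intertwines (f := (phi S (n + 1)).comp (addStrand n)) extendOne
    (fun k κ x => ?_) B κ x
  rw [MonoidHom.comp_apply, addStrand_sigma, phi_sigma_apply, phi_sigma_apply, permHom_sigma,
    lo_idxIncl, hi_idxIncl, ← extendOne_comp_swap]
  exact gauge_phiHom _ _ _ x

theorem gauge_inclA (κ : Fin n → Sˣ) (x : AAlg S (Fin n)) :
    gauge S (extendOne κ) (inclA S n x) = inclA S n (gauge S κ x) := by
  have : (gauge S (extendOne κ)).comp (inclA S n) = (inclA S n).comp (gauge S κ) := by
    apply AAlg_hom_ext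
    intro i j _
    simp [inclA_matA, gauge_matA, extendOne_castSucc]
  exact DFunLike.congr_fun this x

theorem gauge_phi_matA (κ : Fin n → Sˣ) (B : BraidGroup n) (i j : Fin n) :
    gauge S κ (phi S n B (matA S (Fin n) i j)) =
      ((κ (permHom n B i) * (κ (permHom n B j))⁻¹ : Sˣ) : S) • phi S n B (matA S (Fin n) i j) := by
  rw [gauge_phi, gauge_matA, map_smul]
  rfl

/-- Give the added strand weight 1 and rescale the defining equation. After division by the weight
of its left side it again has the defining form, so by uniqueness the entry in row i and column l
has weight κ_{π(i)}κ_l⁻¹. -/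
theorem gauge_PhiL (κ : Fin n → Sˣ) (B : BraidGroup n) (i l : Fin n) :
    gauge S κ (PhiL S B i l) = ((κ (permHom n B i) * (κ l)⁻¹ : Sˣ) : S) • PhiL S B i l := by
  have key : IsPhiL B (fun i l => (((κ (permHom n B i))⁻¹ * κ l : Sˣ) : S) •
      gauge S κ (PhiL S B i l)) := by
    intro i
    have h := congrArg (gauge S (extendOne κ)) (isPhiL_PhiL (S := S) B i)
    rw [gauge_phi_addStrand, gauge_matA, map_smul, extendOne_castSucc, extendOne_last, inv_one,
      mul_one, map_sum] at h
    have h2 := congrArg (fun y => (((κ (permHom n B i))⁻¹ : Sˣ) : S) • y) h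
    simp only [Function.comp_apply, smul_smul, Units.inv_mul, one_smul] at h2
    rw [h2, Finset.smul_sum]
    refine Finset.sum_congr rfl (fun l _ => ?_)
    rw [map_mul, gauge_inclA, gauge_matA, extendOne_castSucc, extendOne_last, inv_one, mul_one,
      map_smul, mul_smul_comm, smul_smul, smul_mul_assoc, Units.val_mul]
  have h := congrFun (congrFun (IsPhiL.unique (isPhiL_PhiL B) key) i) l
  conv_rhs => rw [h, smul_smul, ← Units.val_mul]
  simp [mul_assoc]

theorem gauge_PhiR (κ : Fin n → Sˣ) (B : BraidGroup n) (l i : Fin n) :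
    gauge S κ (PhiR S B l i) = ((κ l * (κ (permHom n B i))⁻¹ : Sˣ) : S) • PhiR S B l i := by
  have key : IsPhiR B (fun l i => (((κ l)⁻¹ * κ (permHom n B i) : Sˣ) : S) •
      gauge S κ (PhiR S B l i)) := by
    intro i
    have h := congrArg (gauge S (extendOne κ)) (isPhiR_PhiR (S := S) B i)
    rw [gauge_phi_addStrand, gauge_matA, map_smul, extendOne_castSucc, extendOne_last,
      one_mul, map_sum] at h
    have h2 := congrArg (fun y => ((κ (permHom n B i) : Sˣ) : S) • y) h
    simp only [Function.comp_apply, smul_smul, Units.mul_inv, one_smul] at h2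
    rw [h2, Finset.smul_sum]
    refine Finset.sum_congr rfl (fun l _ => ?_)
    rw [map_mul, gauge_inclA, gauge_matA, extendOne_castSucc, extendOne_last, one_mul,
      map_smul, smul_mul_assoc, mul_smul_comm, smul_smul, Units.val_mul, mul_comm ((κ l)⁻¹ : Sˣ).val]
  have h := congrFun (congrFun (IsPhiR.unique (isPhiR_PhiR B) key) l) i
  conv_rhs => rw [h, smul_smul, ← Units.val_mul]
  simp [mul_assoc]

theorem PhiL_one : PhiL S (1 : BraidGroup n) = 1 := by
  refine IsPhiL.unique (isPhiL_PhiL _) (fun i => ?_)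
  simp [Matrix.one_apply, apply_ite (inclA S n)]

theorem PhiR_one : PhiR S (1 : BraidGroup n) = 1 := by
  refine IsPhiR.unique (isPhiR_PhiR _) (fun i => ?_)
  simp [Matrix.one_apply, apply_ite (inclA S n)]

theorem PhiL_mul (B C : BraidGroup n) :
    PhiL S (B * C) = (PhiL S C).map (phi S n B) * PhiL S B :=
  IsPhiL.unique (isPhiL_PhiL _) ((isPhiL_PhiL B).mul (isPhiL_PhiL C))

theorem PhiR_mul (B C : BraidGroup n) :
    PhiR S (B * C) = PhiR S B * (PhiR S C).map (phi S n B) :=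
  IsPhiR.unique (isPhiR_PhiR _) ((isPhiR_PhiR B).mul (isPhiR_PhiR C))

theorem phi_PhiL_inv_mul (B : BraidGroup n) :
    (PhiL S B⁻¹).map (phi S n B) * PhiL S B = 1 := by
  rw [← PhiL_mul, mul_inv_cancel, PhiL_one]

theorem phi_phi_inv (B : BraidGroup n) (x : AAlg S (Fin n)) :
    phi S n B (phi S n B⁻¹ x) = x := by
  rw [← AlgEquiv.mul_apply, ← map_mul, mul_inv_cancel, map_one, AlgEquiv.one_apply]

/-- The entries do not commute, so the second inverse identity needs its own argument: apply φ_B to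
the chain rule for B⁻¹B = 1. -/
theorem PhiL_mul_phi_inv (B : BraidGroup n) :
    PhiL S B * (PhiL S B⁻¹).map (phi S n B) = 1 := by
  have h := congrArg (fun M => M.map (phi S n B)) (PhiL_mul (S := S) B⁻¹ B)
  simp only [inv_mul_cancel, PhiL_one] at h
  rw [Matrix.map_mul, Matrix.map_one _ (map_zero _) (map_one _), Matrix.map_map] at h
  rw [h]
  congr 1
  ext i j
  simp

theorem PhiR_mul_phi_inv (B : BraidGroup n) :
    PhiR S B * (PhiR S B⁻¹).map (phi S n B) = 1 := by
  rw [← PhiR_mul, mul_inv_cancel, PhiR_one]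

theorem phi_PhiR_inv_mul (B : BraidGroup n) :
    (PhiR S B⁻¹).map (phi S n B) * PhiR S B = 1 := by
  have h := congrArg (fun M => M.map (phi S n B)) (PhiR_mul (S := S) B⁻¹ B)
  simp only [inv_mul_cancel, PhiR_one] at h
  rw [Matrix.map_mul, Matrix.map_one _ (map_zero _) (map_one _), Matrix.map_map] at h
  rw [h]
  congr 1
  ext i j
  simp

end GaugePhi

/-! ## Rescaled and triangularly weighted matrices -/

section Scale

variable {S : Type*} [CommRing S] {A A' : Type*} [Ring A] [Algebra S A] [Ring A'] [Algebra S A']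
  {n : ℕ}

/-- The matrix with entries `ν_i κ_j⁻¹ M_{ij}`. -/
def scale (ν κ : Fin n → Sˣ) (M : Matrix (Fin n) (Fin n) A) : Matrix (Fin n) (Fin n) A :=
  fun i j => ((ν i * (κ j)⁻¹ : Sˣ) : S) • M i j

variable (ν κ ρ : Fin n → Sˣ) (M M' : Matrix (Fin n) (Fin n) A)

theorem scale_mul : scale ν κ M * scale κ ρ M' = scale ν ρ (M * M') := by
  ext i j
  simp only [scale, Matrix.mul_apply, smul_mul_smul_comm, Finset.smul_sum, ← Units.val_mul]
  refine Finset.sum_congr rfl (fun l _ => ?_)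
  congr 2
  group

theorem scale_one : scale ν ν (1 : Matrix (Fin n) (Fin n) A) = 1 := by
  ext i j
  by_cases h : i = j
  · subst h; simp [scale]
  · simp [scale, h]

theorem scale_scale (ν' κ' : Fin n → Sˣ) :
    scale ν κ (scale ν' κ' M) = scale (ν * ν') (κ * κ') M := by
  ext i j
  simp only [scale, smul_smul, ← Units.val_mul, Pi.mul_apply, mul_inv]
  congr 2
  exact mul_mul_mul_comm _ _ _ _

theorem scale_one_one : scale (1 : Fin n → Sˣ) 1 M = M := by
  ext i j; simp [scale]

theorem scale_add : scale ν κ (M + M') = scale ν κ M + scale ν κ M' := by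
  ext i j; simp [scale]

theorem scale_sub : scale ν κ (M - M') = scale ν κ M - scale ν κ M' := by
  ext i j; simp [scale, smul_sub]

theorem scale_neg : scale ν κ (-M) = -scale ν κ M := by
  ext i j; simp [scale]

theorem mapMatrix_scale (f : A →ₐ[S] A') :
    f.mapMatrix (scale ν κ M) = scale ν κ (f.mapMatrix M) := by
  ext i j; simp [scale]

/-- The matrix with entries `s M_{ij}`, `d`, `t M_{ij}` below, on and above the diagonal. -/
def tri (s t d : S) (M : Matrix (Fin n) (Fin n) A) : Matrix (Fin n) (Fin n) A := fun i j =>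
  if j < i then s • M i j else if i = j then algebraMap S A d else t • M i j

variable (s t d : S)

/-- The constant diagonal belongs to only one of the two terms. This is the form needed to compare
Â, which has a prescribed diagonal, with B̂, whose diagonal is zero. -/
theorem tri_sub : tri s t d (M - M') = tri s t d M - tri s t 0 M' := by
  ext i j
  simp only [tri, Matrix.sub_apply]
  split_ifs <;> simp [smul_sub]

theorem tri_neg : tri s t 0 (-M) = -tri s t 0 M := by
  ext i j
  simp only [tri, Matrix.neg_apply]
  split_ifs <;> simp

/-- Conjugation by a diagonal matrix of central units fixes scalar diagonal entries; this needs the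
same weights on rows and columns. -/
theorem scale_tri : scale ν ν (tri s t d M) = tri s t d (scale ν ν M) := by
  ext i j
  simp only [tri, scale]
  split_ifs with h1 h2
  · rw [smul_comm]
  · subst h2; simp
  · rw [smul_comm]

theorem mapMatrix_tri (f : A →ₐ[S] A') : f.mapMatrix (tri s t d M) = tri s t d (f.mapMatrix M) := by
  ext i j
  simp only [tri, AlgHom.mapMatrix_apply, Matrix.map_apply]
  split_ifs <;> simp

end Scale

/-! ### The matrices of the transverse DGA and their reflections -/

section Matrices

variable {S : Type*} [CommRing S] {n : ℕ}

theorem hatA_eq_tri (mu : Sˣ) (U : S) (n : ℕ) :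
    hatA mu U n = tri 1 (mu * U) (-1 - mu * U) (ctA S n) := by
  ext i j; simp [hatA, tri]

theorem checkA_eq_tri (mu : Sˣ) (V : S) (n : ℕ) :
    checkA mu V n = tri V (mu : S) (-V - mu) (ctA S n) := by
  ext i j; simp [checkA, tri]

theorem hatB_eq_tri (mu : Sˣ) (U : S) (n : ℕ) :
    hatB mu U n = tri 1 (mu * U) 0 (ctB S n) := by
  ext i j; simp [hatB, tri]

theorem checkB_eq_tri (mu : Sˣ) (V : S) (n : ℕ) :
    checkB mu V n = tri V (mu : S) 0 (ctB S n) := by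
  ext i j; simp [checkB, tri]

theorem Lam_mul (lam mu : Sˣ) (B : BraidGroup n) (M : Matrix (Fin n) (Fin n) (CT S n)) :
    Lam lam mu B * M = scale (lamDiag lam mu B) 1 M := by
  ext i j
  simp [Lam, scale, Algebra.smul_def]

theorem mul_LamInv (lam mu : Sˣ) (B : BraidGroup n) (M : Matrix (Fin n) (Fin n) (CT S n)) :
    M * LamInv lam mu B = scale 1 (lamDiag lam mu B) M := by
  ext i j
  simp [LamInv, scale, Algebra.smul_def, Algebra.commutes]

variable (S n) in
/-- The matrices of generators `𝐄` and `𝐅`. -/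
def ctE : Matrix (Fin n) (Fin n) (CT S n) := fun i j => FreeAlgebra.ι S (Gen.e i j)

variable (S n) in
def ctF : Matrix (Fin n) (Fin n) (CT S n) := fun i j => FreeAlgebra.ι S (Gen.f i j)

theorem toCT_matA (i j : Fin n) (h : i ≠ j) :
    toCT S n (matA S (Fin n) i j) = FreeAlgebra.ι S (Gen.a i j h) := by
  simp [toCT, matA, h]

/-! ### Degrees -/

/-- All entries of the matrix are homogeneous of degree `k`. -/
def HomogeneousMatrix (k : ℕ) (M : Matrix (Fin n) (Fin n) (CT S n)) : Prop :=
  ∀ i j, M i j ∈ degreePart S Gen.deg k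

namespace HomogeneousMatrix

variable {k l : ℕ} {M M' : Matrix (Fin n) (Fin n) (CT S n)}

theorem add (h : HomogeneousMatrix k M) (h' : HomogeneousMatrix k M') :
    HomogeneousMatrix k (M + M') := fun i j => add_mem (h i j) (h' i j)

theorem sub (h : HomogeneousMatrix k M) (h' : HomogeneousMatrix k M') :
    HomogeneousMatrix k (M - M') := fun i j => sub_mem (h i j) (h' i j)

theorem neg (h : HomogeneousMatrix k M) : HomogeneousMatrix k (-M) := fun i j => neg_mem (h i j)

theorem mul (h : HomogeneousMatrix k M) (h' : HomogeneousMatrix l M') :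
    HomogeneousMatrix (k + l) (M * M') := fun i j => by
  rw [Matrix.mul_apply]
  exact Submodule.sum_mem _ (fun m _ => mul_mem_degreePart (h i m) (h' m j))

theorem zero_mul (h : HomogeneousMatrix 0 M) (h' : HomogeneousMatrix l M') :
    HomogeneousMatrix l (M * M') := by
  simpa using h.mul h'

theorem mul_zero (h : HomogeneousMatrix k M) (h' : HomogeneousMatrix 0 M') :
    HomogeneousMatrix k (M * M') := by
  simpa using h.mul h'

theorem scale (h : HomogeneousMatrix k M) (ν κ : Fin n → Sˣ) :
    HomogeneousMatrix k (scale ν κ M) := fun i j => Submodule.smul_mem _ _ (h i j)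

theorem tri_zero (h : HomogeneousMatrix k M) (s t : S) :
    HomogeneousMatrix k (tri s t 0 M) := fun i j => by
  unfold tri
  split_ifs
  · exact Submodule.smul_mem _ _ (h i j)
  · rw [map_zero]; exact zero_mem _
  · exact Submodule.smul_mem _ _ (h i j)

theorem tri (h : HomogeneousMatrix 0 M) (s t d : S) :
    HomogeneousMatrix 0 (tri s t d M) := fun i j => by
  unfold TransverseHomology.tri
  split_ifs
  · exact Submodule.smul_mem _ _ (h i j)
  · exact algebraMap_mem_degreePart _
  · exact Submodule.smul_mem _ _ (h i j)

end HomogeneousMatrix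

theorem toCT_mem_degreePart (x : AAlg S (Fin n)) : toCT S n x ∈ degreePart S Gen.deg 0 := by
  induction x using FreeAlgebra.induction with
  | grade0 r => rw [AlgHom.commutes]; exact algebraMap_mem_degreePart r
  | grade1 x => rw [toCT, FreeAlgebra.lift_ι_apply]; exact ι_mem_degreePart (deg := Gen.deg) (Gen.a _ _ _)
  | mul a b ha hb => rw [map_mul]; simpa using mul_mem_degreePart ha hb
  | add a b ha hb => rw [map_add]; exact add_mem ha hb

theorem homogeneous_toCT (M : Matrix (Fin n) (Fin n) (AAlg S (Fin n))) :
    HomogeneousMatrix 0 ((toCT S n).mapMatrix M) := fun _ _ => toCT_mem_degreePart _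

theorem homogeneous_ctA : HomogeneousMatrix 0 (ctA S n) := fun _ _ => toCT_mem_degreePart _

theorem homogeneous_ctPhiA (B : BraidGroup n) : HomogeneousMatrix 0 (ctPhiA S B) :=
  fun _ _ => toCT_mem_degreePart _

theorem homogeneous_ctPhiL (B : BraidGroup n) : HomogeneousMatrix 0 (ctPhiL S B) :=
  fun _ _ => toCT_mem_degreePart _

theorem homogeneous_ctPhiR (B : BraidGroup n) : HomogeneousMatrix 0 (ctPhiR S B) :=
  fun _ _ => toCT_mem_degreePart _

theorem homogeneous_ctB : HomogeneousMatrix 1 (ctB S n) := fun i j => by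
  unfold ctB
  split_ifs with h
  · exact ι_mem_degreePart (deg := Gen.deg) (Gen.b i j h)
  · exact zero_mem _

theorem homogeneous_ctC : HomogeneousMatrix 1 (ctC S n) := fun i j =>
  ι_mem_degreePart (deg := Gen.deg) (Gen.c i j)

theorem homogeneous_ctD : HomogeneousMatrix 1 (ctD S n) := fun i j =>
  ι_mem_degreePart (deg := Gen.deg) (Gen.d i j)

theorem homogeneous_ctE : HomogeneousMatrix 2 (ctE S n) := fun i j =>
  ι_mem_degreePart (deg := Gen.deg) (Gen.e i j)

theorem homogeneous_ctF : HomogeneousMatrix 2 (ctF S n) := fun i j =>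
  ι_mem_degreePart (deg := Gen.deg) (Gen.f i j)

theorem homogeneous_hatA (mu : Sˣ) (U : S) : HomogeneousMatrix 0 (hatA mu U n) := by
  rw [hatA_eq_tri]; exact homogeneous_ctA.tri _ _ _

theorem homogeneous_checkA (mu : Sˣ) (V : S) : HomogeneousMatrix 0 (checkA mu V n) := by
  rw [checkA_eq_tri]; exact homogeneous_ctA.tri _ _ _

theorem homogeneous_hatB (mu : Sˣ) (U : S) : HomogeneousMatrix 1 (hatB mu U n) := by
  rw [hatB_eq_tri]; exact homogeneous_ctB.tri_zero _ _

theorem homogeneous_checkB (mu : Sˣ) (V : S) : HomogeneousMatrix 1 (checkB mu V n) := by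
  rw [checkB_eq_tri]; exact homogeneous_ctB.tri_zero _ _

theorem diffGen_of_deg_eq_zero (lam mu : Sˣ) (U V : S) (B : BraidGroup n) (x : Gen n)
    (hx : x.deg = 0) : diffGen lam mu U V B x = 0 := by
  cases x <;> simp_all [Gen.deg, diffGen]

theorem diffGen_mem_degreePart (lam mu : Sˣ) (U V : S) (B : BraidGroup n) (x : Gen n) (k : ℕ)
    (hx : x.deg = k + 1) : diffGen lam mu U V B x ∈ degreePart S Gen.deg k := by
  cases x with
  | a => simp [Gen.deg] at hx
  | b i j h =>
    obtain rfl : k = 0 := by simpa [Gen.deg] using hx.symm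
    rw [diffGen, mul_LamInv, Lam_mul]
    exact (homogeneous_ctA.sub (((homogeneous_ctPhiA B).scale _ _).scale _ _)) i j
  | c i j =>
    obtain rfl : k = 0 := by simpa [Gen.deg] using hx.symm
    rw [diffGen, Lam_mul]
    exact ((homogeneous_hatA _ _).sub
      (((homogeneous_ctPhiL B).scale _ _).mul_zero (homogeneous_checkA _ _))) i j
  | d i j =>
    obtain rfl : k = 0 := by simpa [Gen.deg] using hx.symm
    rw [diffGen, mul_LamInv]
    exact ((homogeneous_checkA _ _).sub
      (((homogeneous_hatA _ _).mul_zero (homogeneous_ctPhiR B)).scale _ _)) i j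
  | e i j =>
    obtain rfl : k = 1 := by simpa [Gen.deg] using hx.symm
    rw [diffGen, Lam_mul]
    exact (((homogeneous_hatB _ _).sub homogeneous_ctC).sub
      (((homogeneous_ctPhiL B).scale _ _).zero_mul homogeneous_ctD)) i j
  | f i j =>
    obtain rfl : k = 1 := by simpa [Gen.deg] using hx.symm
    rw [diffGen, mul_LamInv]
    exact (((homogeneous_checkB _ _).sub homogeneous_ctD).sub
      ((homogeneous_ctC.mul_zero (homogeneous_ctPhiR B)).scale _ _)) i j

theorem Gen.deg_le_two (x : Gen n) : x.deg ≤ 2 := by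
  cases x <;> simp [Gen.deg]

/-- The opposite differential is the derivation whose values on generators are the reversals of
those of the differential. -/
theorem diffOpCT_eq (lam mu : Sˣ) (U V : S) (B : BraidGroup n) :
    diffOpCT lam mu U V B = diffOf Gen.deg (fun x => star (diffGen lam mu U V B x)) := by
  have h0 := diffGen_of_deg_eq_zero lam mu U V B
  have h1 := diffGen_mem_degreePart lam mu U V B
  rw [diffOpCT, diffCT, opMap_diffOf_opMap h0 h1]
  congr 1
  funext x
  cases hx : x.deg with
  | zero => rw [h0 x hx]; simp
  | succ k => exact opMap_eq_star (h1 x k hx) (by have := x.deg_le_two; omega)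

/-! ### Reflecting generators -/

/-- The generator with reflected indices. -/
def Gen.reflect : Gen n → Gen n
  | .a i j h => .a j.rev i.rev (fun e => h (Fin.rev_injective e).symm)
  | .b i j h => .b j.rev i.rev (fun e => h (Fin.rev_injective e).symm)
  | .c i j => .c j.rev i.rev
  | .d i j => .d j.rev i.rev
  | .e i j => .e j.rev i.rev
  | .f i j => .f j.rev i.rev

theorem Gen.reflect_reflect (x : Gen n) : x.reflect.reflect = x := by
  cases x <;> simp [Gen.reflect]

theorem Gen.deg_reflect (x : Gen n) : x.reflect.deg = x.deg := by
  cases x <;> rfl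

variable (S n) in
/-- The algebra automorphism reflecting the indices of the generators. -/
def reflectHom : CT S n →ₐ[S] CT S n := FreeAlgebra.lift S (fun x => FreeAlgebra.ι S x.reflect)

theorem reflectHom_ι (x : Gen n) :
    reflectHom S n (FreeAlgebra.ι S x) = FreeAlgebra.ι S x.reflect := by
  simp [reflectHom]

theorem reflectHom_comp_self : (reflectHom S n).comp (reflectHom S n) = AlgHom.id S _ := by
  apply FreeAlgebra.hom_ext
  funext x
  simp [reflectHom_ι, Gen.reflect_reflect]

theorem reflectHom_reflectHom (x : CT S n) : reflectHom S n (reflectHom S n x) = x :=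
  DFunLike.congr_fun reflectHom_comp_self x

/-- The anti-automorphism reflecting the indices of the generators. -/
def flipCT (x : CT S n) : CT S n := reflectHom S n (star x)

theorem flipCT_mul (x y : CT S n) : flipCT (x * y) = flipCT y * flipCT x := by
  simp [flipCT]

theorem flipCT_sub (x y : CT S n) : flipCT (x - y) = flipCT x - flipCT y := by
  rw [flipCT, sub_eq_add_neg, star_add, star_neg, map_add, map_neg, ← sub_eq_add_neg]; rfl

theorem flipCT_smul (r : S) (x : CT S n) : flipCT (r • x) = r • flipCT x := by
  rw [flipCT, star_smul_freeAlgebra, map_smul]; rfl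

theorem flipCT_algebraMap (r : S) : flipCT (algebraMap S (CT S n) r) = algebraMap S _ r := by
  rw [flipCT, FreeAlgebra.star_algebraMap, AlgHom.commutes]

theorem flipCT_sum {J : Type*} (s : Finset J) (f : J → CT S n) :
    flipCT (∑ j ∈ s, f j) = ∑ j ∈ s, flipCT (f j) := by
  simp [flipCT]

theorem flipCT_ι (x : Gen n) : flipCT (FreeAlgebra.ι S x) = FreeAlgebra.ι S x.reflect := by
  rw [flipCT, FreeAlgebra.star_ι, reflectHom_ι]

theorem flipCT_toCT (x : AAlg S (Fin n)) :
    flipCT (toCT S n x) = toCT S n (flipA Fin.revPerm x) := by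
  induction x using FreeAlgebra.induction with
  | grade0 r => rw [AlgHom.commutes, flipCT_algebraMap, flipA, AlgHom.commutes]; exact ((toCT S n).commutes r).symm
  | grade1 x =>
    obtain ⟨⟨i, j⟩, h⟩ := x
    have h' : i ≠ j := h
    have e : FreeAlgebra.ι S (⟨(i, j), h⟩ : OffDiag (Fin n)) = matA S (Fin n) i j := by
      simp [matA, h']
    rw [e, flipA_matA, toCT_matA _ _ h', toCT_matA _ _ (fun e => h' (Fin.revPerm.injective e).symm),
      flipCT_ι]
    rfl
  | mul a b ha hb => rw [map_mul, flipCT_mul, ha, hb, flipA_mul, map_mul]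
  | add a b ha hb =>
    have h1 : ∀ x y : CT S n, flipCT (x + y) = flipCT x + flipCT y := fun x y => by simp [flipCT]
    have h2 : flipA Fin.revPerm (a + b) = flipA Fin.revPerm a + flipA Fin.revPerm b := by
      simp [flipA]
    rw [map_add, h1, ha, hb, h2, map_add]

/-- Reflection of a matrix in the antidiagonal, combined with `flipCT`. -/
def reflect (M : Matrix (Fin n) (Fin n) (CT S n)) : Matrix (Fin n) (Fin n) (CT S n) :=
  fun i j => flipCT (M j.rev i.rev)

theorem reflect_mul (M M' : Matrix (Fin n) (Fin n) (CT S n)) :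
    reflect (M * M') = reflect M' * reflect M := by
  ext i j
  rw [reflect, Matrix.mul_apply, flipCT_sum, Matrix.mul_apply, ← Equiv.sum_comp Fin.revPerm]
  simp [reflect, flipCT_mul]

theorem reflect_sub (M M' : Matrix (Fin n) (Fin n) (CT S n)) :
    reflect (M - M') = reflect M - reflect M' := by
  ext i j
  simp [reflect, flipCT_sub]

/-- Reflection exchanges rows with columns, so row weights become column weights. As `scale` inverts
the column weights, both families get inverted; this is how Λ_B turns into the inverse of a diagonal
matrix with its marked entry at the other end. -/
theorem reflect_scale (ν κ : Fin n → Sˣ) (M : Matrix (Fin n) (Fin n) (CT S n)) :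
    reflect (scale ν κ M) = scale (κ ∘ Fin.rev)⁻¹ (ν ∘ Fin.rev)⁻¹ (reflect M) := by
  ext i j
  simp [reflect, scale, flipCT_smul, mul_comm]

/-- The map (i, j) ↦ (n + 1 − j, n + 1 − i) preserves i > j, i = j and i < j. An ordinary
transposition would interchange the weights below and above the diagonal. -/
theorem reflect_tri (s t d : S) (M : Matrix (Fin n) (Fin n) (CT S n)) :
    reflect (tri s t d M) = tri s t d (reflect M) := by
  ext i j
  simp only [reflect, tri, Fin.rev_lt_rev, Fin.rev_inj, apply_ite flipCT, flipCT_smul,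
    flipCT_algebraMap, eq_comm]

theorem reflect_toCT (M : Matrix (Fin n) (Fin n) (AAlg S (Fin n))) :
    reflect (M.map (toCT S n)) = (reflectA M).map (toCT S n) := by
  ext i j
  simp [reflect, reflectA, flipCT_toCT]

theorem reflect_ctA : reflect (ctA S n) = ctA S n := by
  rw [ctA, reflect_toCT]
  congr 1
  ext i j
  simp [reflectA, flipA_matA]

theorem reflect_ctB : reflect (ctB S n) = ctB S n := by
  ext i j
  rw [reflect, ctB, ctB]
  by_cases h : i = j
  · subst h; simp [flipCT]
  · have h' : j.rev ≠ i.rev := fun e => h (Fin.rev_injective e).symm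
    rw [dif_pos h, dif_pos h', flipCT_ι]
    simp [Gen.reflect]

theorem reflect_ctC : reflect (ctC S n) = ctC S n := by
  ext i j; simp [reflect, ctC, flipCT_ι, Gen.reflect]

theorem reflect_ctD : reflect (ctD S n) = ctD S n := by
  ext i j; simp [reflect, ctD, flipCT_ι, Gen.reflect]

theorem reflect_hatA (mu : Sˣ) (U : S) : reflect (hatA mu U n) = hatA mu U n := by
  rw [hatA_eq_tri, reflect_tri, reflect_ctA]

theorem reflect_checkA (mu : Sˣ) (V : S) : reflect (checkA mu V n) = checkA mu V n := by
  rw [checkA_eq_tri, reflect_tri, reflect_ctA]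

theorem reflect_hatB (mu : Sˣ) (U : S) : reflect (hatB mu U n) = hatB mu U n := by
  rw [hatB_eq_tri, reflect_tri, reflect_ctB]

theorem reflect_checkB (mu : Sˣ) (V : S) : reflect (checkB mu V n) = checkB mu V n := by
  rw [checkB_eq_tri, reflect_tri, reflect_ctB]

theorem reflect_ctPhiL (B : BraidGroup n) : reflect (ctPhiL S B) = ctPhiR S (braidStar n B) := by
  rw [ctPhiL, reflect_toCT, ctPhiR, PhiR_braidStar]

theorem reflect_ctPhiR (B : BraidGroup n) : reflect (ctPhiR S B) = ctPhiL S (braidStar n B) := by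
  rw [ctPhiR, reflect_toCT, ctPhiL, PhiL_braidStar]

theorem ctPhiA_eq (B : BraidGroup n) :
    ctPhiA S B = ((matA S (Fin n)).map (phi S n B)).map (toCT S n) := by
  rw [Matrix.map_map]; rfl

theorem reflect_ctPhiA (B : BraidGroup n) : reflect (ctPhiA S B) = ctPhiA S (braidStar n B) := by
  rw [ctPhiA_eq, reflect_toCT, ctPhiA_eq, phi_braidStar_matA]

/-- The reflection of the opposite differential, on generators: the roles of `Φ^L` and `Φ^R` are
exchanged. The braid `B` and the diagonal matrix `ν` are arbitrary. -/
def reflectedGen (mu : Sˣ) (U V : S) (ν : Fin n → Sˣ) (B : BraidGroup n) : Gen n → CT S n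
  | .a _ _ _ => 0
  | .b i j _ => (ctA S n - scale ν⁻¹ ν⁻¹ (ctPhiA S B)) i j
  | .c i j => (hatA mu U n - checkA mu V n * scale 1 ν⁻¹ (ctPhiR S B)) i j
  | .d i j => (checkA mu V n - scale ν⁻¹ 1 (ctPhiL S B) * hatA mu U n) i j
  | .e i j => (hatB mu U n - ctC S n - ctD S n * scale 1 ν⁻¹ (ctPhiR S B)) i j
  | .f i j => (checkB mu V n - ctD S n - scale ν⁻¹ 1 (ctPhiL S B) * ctC S n) i j

theorem mul_scale_one (ν : Fin n → Sˣ) (M M' : Matrix (Fin n) (Fin n) (CT S n)) :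
    scale 1 ν (M * M') = M * scale 1 ν M' := by
  rw [← scale_mul 1 1 ν, scale_one_one]

/-- All matrices of generators, with or without hats and checks, are fixed by the reflection. Only
the order of the products changes, and Φ^L, Φ^R are exchanged with a passage from B to B^*. -/
theorem flipCT_diffGen_reflect (lam mu : Sˣ) (U V : S) (B : BraidGroup n) (x : Gen n) :
    flipCT (diffGen lam mu U V B x.reflect) =
      reflectedGen mu U V (lamDiag lam mu B ∘ Fin.rev) (braidStar n B) x := by
  have h1 : ((1 : Fin n → Sˣ) ∘ Fin.rev)⁻¹ = 1 := by funext i; simp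
  cases x with
  | a i j h => simp [Gen.reflect, diffGen, reflectedGen, flipCT]
  | b i j h =>
    rw [Gen.reflect, diffGen, reflectedGen, mul_LamInv, Lam_mul]
    change reflect _ i j = _
    rw [reflect_sub, reflect_scale, reflect_scale, scale_scale, h1, one_mul, mul_one, reflect_ctA,
      reflect_ctPhiA]
  | c i j =>
    rw [Gen.reflect, diffGen, reflectedGen, Lam_mul]
    change reflect _ i j = _
    rw [reflect_sub, reflect_mul, reflect_scale, h1, reflect_hatA, reflect_checkA, reflect_ctPhiL]
  | d i j =>
    rw [Gen.reflect, diffGen, reflectedGen, mul_LamInv, mul_scale_one]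
    change reflect _ i j = _
    rw [reflect_sub, reflect_mul, reflect_scale, h1, reflect_hatA, reflect_checkA, reflect_ctPhiR]
  | e i j =>
    rw [Gen.reflect, diffGen, reflectedGen, Lam_mul]
    change reflect _ i j = _
    rw [reflect_sub, reflect_sub, reflect_mul, reflect_scale, h1, reflect_hatB, reflect_ctC,
      reflect_ctD, reflect_ctPhiL]
  | f i j =>
    rw [Gen.reflect, diffGen, reflectedGen, mul_LamInv, mul_scale_one]
    change reflect _ i j = _
    rw [reflect_sub, reflect_sub, reflect_mul, reflect_scale, h1, reflect_checkB, reflect_ctC,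
      reflect_ctD, reflect_ctPhiR]

/-- Reflection of the generators intertwines the reflected and the opposite differential. -/
theorem reflectHom_diffOf (lam mu : Sˣ) (U V : S) (B : BraidGroup n) (x : CT S n) :
    reflectHom S n (diffOf Gen.deg
      (reflectedGen mu U V (lamDiag lam mu B ∘ Fin.rev) (braidStar n B)) x) =
      diffOpCT lam mu U V B (reflectHom S n x) := by
  rw [diffOpCT_eq]
  refine map_diffOf_of_generators _ (fun x => ?_) (fun x => ?_) x
  · rw [reflectHom_ι, ← Gen.deg_reflect]
    exact ι_mem_degreePart _
  · rw [← flipCT_diffGen_reflect, flipCT, reflectHom_reflectHom, reflectHom_ι, diffOf_ι]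

end Matrices

/-! ## Homomorphisms in block form -/

section BlockHom

variable {S : Type*} [CommRing S] {n : ℕ}

theorem CT_hom_ext {f g : CT S n →ₐ[S] CT S n}
    (hA : f.mapMatrix (ctA S n) = g.mapMatrix (ctA S n))
    (hB : f.mapMatrix (ctB S n) = g.mapMatrix (ctB S n))
    (hC : f.mapMatrix (ctC S n) = g.mapMatrix (ctC S n))
    (hD : f.mapMatrix (ctD S n) = g.mapMatrix (ctD S n))
    (hE : f.mapMatrix (ctE S n) = g.mapMatrix (ctE S n))
    (hF : f.mapMatrix (ctF S n) = g.mapMatrix (ctF S n)) : f = g := by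
  apply FreeAlgebra.hom_ext
  funext x
  cases x with
  | a i j h =>
    have := congrFun (congrFun hA i) j
    simpa only [AlgHom.mapMatrix_apply, Matrix.map_apply, ctA, toCT_matA i j h, Function.comp_apply]
      using this
  | b i j h =>
    have := congrFun (congrFun hB i) j
    simpa only [AlgHom.mapMatrix_apply, Matrix.map_apply, ctB, dif_pos h, Function.comp_apply]
      using this
  | c i j => exact congrFun (congrFun hC i) j
  | d i j => exact congrFun (congrFun hD i) j
  | e i j => exact congrFun (congrFun hE i) j
  | f i j => exact congrFun (congrFun hF i) j

/-- The homomorphism given by `θ` on the `a_{ij}` and on the other generators, up to conjugation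
by the diagonal matrix `ν`, by `𝐁 ↦ -𝐁`, `𝐂 ↦ -𝐁^ + X₁ (𝐁ˇ - 𝐃) Y₁`, `𝐃 ↦ -𝐁ˇ + X₂ (𝐁^ - 𝐂) Y₂`
and `𝐄 ↦ -X₁ X₂ 𝐄 Y₁ Y₂`, `𝐅 ↦ -X₁ X₂ 𝐅 Y₁ Y₂`. -/
def blockHom (mu : Sˣ) (U V : S) (θ : AAlg S (Fin n) →ₐ[S] AAlg S (Fin n)) (ν : Fin n → Sˣ)
    (X₁ Y₁ X₂ Y₂ : Matrix (Fin n) (Fin n) (AAlg S (Fin n))) : CT S n →ₐ[S] CT S n :=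
  FreeAlgebra.lift S (fun
    | .a i j _ => toCT S n (θ (matA S (Fin n) i j))
    | .b i j _ => (-scale ν ν (ctB S n)) i j
    | .c i j => (scale ν ν (-hatB mu U n + (toCT S n).mapMatrix X₁ * (checkB mu V n - ctD S n) *
        (toCT S n).mapMatrix Y₁)) i j
    | .d i j => (scale ν ν (-checkB mu V n + (toCT S n).mapMatrix X₂ * (hatB mu U n - ctC S n) *
        (toCT S n).mapMatrix Y₂)) i j
    | .e i j => (-scale ν ν ((toCT S n).mapMatrix (X₁ * X₂) * ctE S n *
        (toCT S n).mapMatrix (Y₁ * Y₂))) i j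
    | .f i j => (-scale ν ν ((toCT S n).mapMatrix (X₁ * X₂) * ctF S n *
        (toCT S n).mapMatrix (Y₁ * Y₂))) i j)

variable (mu : Sˣ) (U V : S) (θ : AAlg S (Fin n) →ₐ[S] AAlg S (Fin n)) (ν : Fin n → Sˣ)
  (X₁ Y₁ X₂ Y₂ : Matrix (Fin n) (Fin n) (AAlg S (Fin n)))

theorem blockHom_toCT (x : AAlg S (Fin n)) :
    blockHom mu U V θ ν X₁ Y₁ X₂ Y₂ (toCT S n x) = toCT S n (θ x) := by
  have : (blockHom mu U V θ ν X₁ Y₁ X₂ Y₂).comp (toCT S n) = (toCT S n).comp θ := by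
    apply AAlg_hom_ext
    intro i j h
    rw [AlgHom.comp_apply, toCT_matA i j h, blockHom, FreeAlgebra.lift_ι_apply]
    rfl
  exact DFunLike.congr_fun this x

theorem blockHom_mapMatrix_toCT (M : Matrix (Fin n) (Fin n) (AAlg S (Fin n))) :
    (blockHom mu U V θ ν X₁ Y₁ X₂ Y₂).mapMatrix ((toCT S n).mapMatrix M) =
      (toCT S n).mapMatrix (θ.mapMatrix M) := by
  ext i j
  exact blockHom_toCT mu U V θ ν X₁ Y₁ X₂ Y₂ (M i j)

theorem blockHom_ctB :
    (blockHom mu U V θ ν X₁ Y₁ X₂ Y₂).mapMatrix (ctB S n) = -scale ν ν (ctB S n) := by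
  ext i j
  by_cases h : i = j
  · subst h; simp [ctB, scale]
  · rw [AlgHom.mapMatrix_apply, Matrix.map_apply]
    conv_lhs => rw [ctB, dif_pos h, blockHom, FreeAlgebra.lift_ι_apply]

theorem blockHom_ctC : (blockHom mu U V θ ν X₁ Y₁ X₂ Y₂).mapMatrix (ctC S n) =
    scale ν ν (-hatB mu U n + (toCT S n).mapMatrix X₁ * (checkB mu V n - ctD S n) *
        (toCT S n).mapMatrix Y₁) := by
  ext i j
  rw [AlgHom.mapMatrix_apply, Matrix.map_apply, ctC, blockHom, FreeAlgebra.lift_ι_apply]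

theorem blockHom_ctD : (blockHom mu U V θ ν X₁ Y₁ X₂ Y₂).mapMatrix (ctD S n) =
    scale ν ν (-checkB mu V n + (toCT S n).mapMatrix X₂ * (hatB mu U n - ctC S n) *
        (toCT S n).mapMatrix Y₂) := by
  ext i j
  rw [AlgHom.mapMatrix_apply, Matrix.map_apply, ctD, blockHom, FreeAlgebra.lift_ι_apply]

theorem blockHom_ctE : (blockHom mu U V θ ν X₁ Y₁ X₂ Y₂).mapMatrix (ctE S n) =
    -scale ν ν ((toCT S n).mapMatrix (X₁ * X₂) * ctE S n * (toCT S n).mapMatrix (Y₁ * Y₂)) := by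
  ext i j
  rw [AlgHom.mapMatrix_apply, Matrix.map_apply]
  conv_lhs => rw [ctE, blockHom, FreeAlgebra.lift_ι_apply]

theorem blockHom_ctF : (blockHom mu U V θ ν X₁ Y₁ X₂ Y₂).mapMatrix (ctF S n) =
    -scale ν ν ((toCT S n).mapMatrix (X₁ * X₂) * ctF S n * (toCT S n).mapMatrix (Y₁ * Y₂)) := by
  ext i j
  rw [AlgHom.mapMatrix_apply, Matrix.map_apply]
  conv_lhs => rw [ctF, blockHom, FreeAlgebra.lift_ι_apply]

theorem blockHom_hatB :
    (blockHom mu U V θ ν X₁ Y₁ X₂ Y₂).mapMatrix (hatB mu U n) = -scale ν ν (hatB mu U n) := by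
  rw [hatB_eq_tri, mapMatrix_tri, blockHom_ctB, tri_neg, scale_tri]

theorem blockHom_checkB :
    (blockHom mu U V θ ν X₁ Y₁ X₂ Y₂).mapMatrix (checkB mu V n) = -scale ν ν (checkB mu V n) := by
  rw [checkB_eq_tri, mapMatrix_tri, blockHom_ctB, tri_neg, scale_tri]

theorem blockHom_ι_mem_degreePart (x : Gen n) :
    blockHom mu U V θ ν X₁ Y₁ X₂ Y₂ (FreeAlgebra.ι S x) ∈ degreePart S Gen.deg x.deg := by
  rw [blockHom, FreeAlgebra.lift_ι_apply]
  have t := homogeneous_toCT (S := S) (n := n)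
  cases x with
  | a i j h => exact toCT_mem_degreePart _
  | b i j h => exact ((homogeneous_ctB.scale _ _).neg) i j
  | c i j =>
    exact ((((homogeneous_hatB _ _).neg).add
      (((t _).zero_mul ((homogeneous_checkB _ _).sub homogeneous_ctD)).mul_zero (t _))).scale _ _) i j
  | d i j =>
    exact ((((homogeneous_checkB _ _).neg).add
      (((t _).zero_mul ((homogeneous_hatB _ _).sub homogeneous_ctC)).mul_zero (t _))).scale _ _) i j
  | e i j => exact (((((t _).zero_mul homogeneous_ctE).mul_zero (t _)).scale _ _).neg) i j
  | f i j => exact (((((t _).zero_mul homogeneous_ctF).mul_zero (t _)).scale _ _).neg) i j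

theorem mul_scale_mul_cancel {X Y a b Z : Matrix (Fin n) (Fin n) (CT S n)} {ρ : Fin n → Sˣ}
    (h : X * scale ρ ρ a = 1) (h' : scale ρ ρ b * Y = 1) :
    X * scale ρ ρ (a * Z * b) * Y = scale ρ ρ Z := by
  rw [← scale_mul ρ ρ ρ, ← scale_mul ρ ρ ρ]
  calc X * (scale ρ ρ a * scale ρ ρ Z * scale ρ ρ b) * Y
      = X * scale ρ ρ a * scale ρ ρ Z * (scale ρ ρ b * Y) := by simp only [mul_assoc]
    _ = scale ρ ρ Z := by rw [h, h', one_mul, mul_one]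

theorem scale_scale_inv (M : Matrix (Fin n) (Fin n) (CT S n)) :
    scale ν ν (scale ν⁻¹ ν⁻¹ M) = M := by
  rw [scale_scale, mul_inv_cancel, scale_one_one]

variable {ν} in
-- The common cancellation behind the 𝐂 and 𝐃 components of a composite: the two K terms cancel, X
-- and Y undo a and b, and of H − (H − Z) only Z remains. H and K stand for B̂ and B̌ in one case
-- and for B̌ and B̂ in the other.
theorem scale_block_cancel {X Y a b H K Z : Matrix (Fin n) (Fin n) (CT S n)}
    (h : X * scale ν⁻¹ ν⁻¹ a = 1) (h' : scale ν⁻¹ ν⁻¹ b * Y = 1) :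
    scale ν ν (-(-scale ν⁻¹ ν⁻¹ H) + X * (-scale ν⁻¹ ν⁻¹ K -
      scale ν⁻¹ ν⁻¹ (-K + a * (H - Z) * b)) * Y) = Z := by
  have e : -scale ν⁻¹ ν⁻¹ K - scale ν⁻¹ ν⁻¹ (-K + a * (H - Z) * b) =
      -scale ν⁻¹ ν⁻¹ (a * (H - Z) * b) := by
    rw [scale_add, scale_neg]; abel
  rw [e, mul_neg, neg_mul, mul_scale_mul_cancel h h', neg_neg, ← sub_eq_add_neg, ← scale_sub,
    sub_sub_cancel, scale_scale_inv]

variable {ν X₁ Y₁ X₂ Y₂} in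
-- Each of 𝐂 and 𝐃 is sent to an expression in the other, so the coefficients with index 1 of one
-- map meet those with index 2 of the other. The block form includes both `mirrorHom` and
-- `mirrorHomInv`, and both composites are instances of this one computation.
theorem blockHom_comp_blockHom {θ θ' : AAlg S (Fin n) →ₐ[S] AAlg S (Fin n)}
    {X₁' Y₁' X₂' Y₂' : Matrix (Fin n) (Fin n) (AAlg S (Fin n))} (hθ : ∀ x, θ' (θ x) = x)
    (hX₁ : θ'.mapMatrix X₁ * scale ν⁻¹ ν⁻¹ X₂' = 1) (hY₁ : scale ν⁻¹ ν⁻¹ Y₂' * θ'.mapMatrix Y₁ = 1)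
    (hX₂ : θ'.mapMatrix X₂ * scale ν⁻¹ ν⁻¹ X₁' = 1)
    (hY₂ : scale ν⁻¹ ν⁻¹ Y₁' * θ'.mapMatrix Y₂ = 1) :
    (blockHom mu U V θ' ν⁻¹ X₁' Y₁' X₂' Y₂').comp (blockHom mu U V θ ν X₁ Y₁ X₂ Y₂) =
      AlgHom.id S _ := by
  have push : ∀ {X Y : Matrix (Fin n) (Fin n) (AAlg S (Fin n))},
      θ'.mapMatrix X * scale ν⁻¹ ν⁻¹ Y = 1 → (toCT S n).mapMatrix (θ'.mapMatrix X) *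
        scale ν⁻¹ ν⁻¹ ((toCT S n).mapMatrix Y) = 1 := by
    intro X Y h
    rw [← mapMatrix_scale, ← map_mul, h, map_one]
  have push' : ∀ {X Y : Matrix (Fin n) (Fin n) (AAlg S (Fin n))},
      scale ν⁻¹ ν⁻¹ Y * θ'.mapMatrix X = 1 → scale ν⁻¹ ν⁻¹ ((toCT S n).mapMatrix Y) *
        (toCT S n).mapMatrix (θ'.mapMatrix X) = 1 := by
    intro X Y h
    rw [← mapMatrix_scale, ← map_mul, h, map_one]
  have hX : θ'.mapMatrix (X₁ * X₂) * scale ν⁻¹ ν⁻¹ (X₁' * X₂') = 1 := by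
    rw [map_mul, ← scale_mul ν⁻¹ ν⁻¹ ν⁻¹, mul_assoc, ← mul_assoc _ _ (scale _ _ _), hX₂, one_mul, hX₁]
  have hY : scale ν⁻¹ ν⁻¹ (Y₁' * Y₂') * θ'.mapMatrix (Y₁ * Y₂) = 1 := by
    rw [map_mul, ← scale_mul ν⁻¹ ν⁻¹ ν⁻¹, mul_assoc, ← mul_assoc _ _ (θ'.mapMatrix _), hY₁, one_mul,
      hY₂]
  apply CT_hom_ext <;> rw [← AlgHom.mapMatrix_comp, AlgHom.comp_apply, AlgHom.mapMatrix_id,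
    AlgHom.id_apply]
  · change AlgHom.mapMatrix _ (AlgHom.mapMatrix _ ((toCT S n).mapMatrix _)) = _
    rw [blockHom_mapMatrix_toCT, blockHom_mapMatrix_toCT]
    ext i j
    simp [hθ, ctA]
  · rw [blockHom_ctB, map_neg, mapMatrix_scale, blockHom_ctB, scale_neg, neg_neg, scale_scale_inv]
  · rw [blockHom_ctC, mapMatrix_scale, map_add, map_neg, map_mul, map_mul, map_sub, blockHom_hatB,
      blockHom_checkB, blockHom_ctD, blockHom_mapMatrix_toCT,
      blockHom_mapMatrix_toCT, scale_block_cancel (push hX₁) (push' hY₁)]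
  · rw [blockHom_ctD, mapMatrix_scale, map_add, map_neg, map_mul, map_mul, map_sub, blockHom_hatB,
      blockHom_checkB, blockHom_ctC, blockHom_mapMatrix_toCT,
      blockHom_mapMatrix_toCT, scale_block_cancel (push hX₂) (push' hY₂)]
  · rw [blockHom_ctE, map_neg, mapMatrix_scale, map_mul, map_mul, blockHom_ctE,
      blockHom_mapMatrix_toCT, blockHom_mapMatrix_toCT, mul_neg, neg_mul,
      mul_scale_mul_cancel (push hX) (push' hY), scale_neg, neg_neg, scale_scale_inv]
  · rw [blockHom_ctF, map_neg, mapMatrix_scale, map_mul, map_mul, blockHom_ctF,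
      blockHom_mapMatrix_toCT, blockHom_mapMatrix_toCT, mul_neg, neg_mul,
      mul_scale_mul_cancel (push hX) (push' hY), scale_neg, neg_neg, scale_scale_inv]

end BlockHom

/-! ## Differentials of matrices -/

section MatrixDiff

variable {S : Type*} [CommRing S] {n : ℕ} {D : Gen n → CT S n}

/-- Entries coming from the a_{ij} have degree 0: their differential vanishes and they produce no
Leibniz sign. The derivation is therefore linear over them on both sides. -/
theorem mapMatrix_diffOf_mul (h0 : ∀ x, Gen.deg x = 0 → D x = 0)
    (X Y : Matrix (Fin n) (Fin n) (AAlg S (Fin n))) (Z : Matrix (Fin n) (Fin n) (CT S n)) :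
    (diffOf Gen.deg D).mapMatrix ((toCT S n).mapMatrix X * Z * (toCT S n).mapMatrix Y) =
      (toCT S n).mapMatrix X * (diffOf Gen.deg D).mapMatrix Z * (toCT S n).mapMatrix Y := by
  have hs : ∀ x, signHom S Gen.deg (toCT S n x) = toCT S n x := fun x => by
    rw [signHom_of_mem (toCT_mem_degreePart x), pow_zero, one_smul]
  have hd : ∀ x, diffOf Gen.deg D (toCT S n x) = 0 := fun x =>
    diffOf_degreePart_zero h0 (toCT_mem_degreePart x)
  ext i j
  simp only [LinearMap.mapMatrix_apply, Matrix.map_apply, Matrix.mul_apply, AlgHom.mapMatrix_apply,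
    map_sum, diffOf_mul, hs, hd, mul_zero, add_zero, zero_mul, zero_add]

theorem mapMatrix_linearMap_scale (f : CT S n →ₗ[S] CT S n) (ν κ : Fin n → Sˣ)
    (M : Matrix (Fin n) (Fin n) (CT S n)) :
    f.mapMatrix (scale ν κ M) = scale ν κ (f.mapMatrix M) := by
  ext i j; simp [scale]

theorem mapMatrix_linearMap_tri (f : CT S n →ₗ[S] CT S n) (s t : S)
    (M : Matrix (Fin n) (Fin n) (CT S n)) :
    f.mapMatrix (tri s t 0 M) = tri s t 0 (f.mapMatrix M) := by
  ext i j
  simp only [tri, LinearMap.mapMatrix_apply, Matrix.map_apply]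
  split_ifs <;> simp

end MatrixDiff

/-! ## The isomorphism -/

section Isomorphism

variable {S : Type*} [CommRing S] {n : ℕ}

/-- Rescaling preserves inverses. The rescaled matrix Φ^L_G has known weights, so its inverse
carries the opposite ones, by uniqueness of inverses. -/
theorem gauge_mapMatrix_inv_PhiL (κ : Fin n → Sˣ) (G : BraidGroup n) :
    (gauge S κ).mapMatrix ((PhiL S G⁻¹).map (phi S n G)) =
      scale κ (κ ∘ permHom n G) ((PhiL S G⁻¹).map (phi S n G)) := by
  have h : (gauge S κ).mapMatrix (PhiL S G) = scale (κ ∘ permHom n G) κ (PhiL S G) := by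
    ext i j; exact gauge_PhiL κ G i j
  refine left_inv_eq_right_inv (a := (gauge S κ).mapMatrix (PhiL S G)) ?_ ?_
  · rw [← map_mul, phi_PhiL_inv_mul, map_one]
  · rw [h, scale_mul, PhiL_mul_phi_inv, scale_one]

theorem gauge_mapMatrix_inv_PhiR (κ : Fin n → Sˣ) (G : BraidGroup n) :
    (gauge S κ).mapMatrix ((PhiR S G⁻¹).map (phi S n G)) =
      scale (κ ∘ permHom n G) κ ((PhiR S G⁻¹).map (phi S n G)) := by
  have h : (gauge S κ).mapMatrix (PhiR S G) = scale κ (κ ∘ permHom n G) (PhiR S G) := by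
    ext i j; exact gauge_PhiR κ G i j
  refine left_inv_eq_right_inv (a := (gauge S κ).mapMatrix (PhiR S G)) ?_ ?_
  · rw [← map_mul, phi_PhiR_inv_mul, map_one]
  · rw [h, scale_mul, PhiR_mul_phi_inv, scale_one]

variable (S) in
/-- The inverse of `Λ⁻¹ Φ^L` for a diagonal matrix `Λ` with entries `ν`. -/
def invL (ν : Fin n → Sˣ) (G : BraidGroup n) : Matrix (Fin n) (Fin n) (AAlg S (Fin n)) :=
  scale 1 ν⁻¹ ((PhiL S G⁻¹).map (phi S n G))

variable (S) in
/-- The inverse of `Φ^R Λ` for a diagonal matrix `Λ` with entries `ν`. -/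
def invR (ν : Fin n → Sˣ) (G : BraidGroup n) : Matrix (Fin n) (Fin n) (AAlg S (Fin n)) :=
  scale ν⁻¹ 1 ((PhiR S G⁻¹).map (phi S n G))

theorem invL_mul (ν : Fin n → Sˣ) (G : BraidGroup n) :
    invL S ν G * scale ν⁻¹ 1 (PhiL S G) = 1 := by
  rw [invL, scale_mul, phi_PhiL_inv_mul, scale_one]

theorem mul_invL (ν : Fin n → Sˣ) (G : BraidGroup n) :
    scale ν⁻¹ 1 (PhiL S G) * invL S ν G = 1 := by
  rw [invL, scale_mul, PhiL_mul_phi_inv, scale_one]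

theorem invR_mul (ν : Fin n → Sˣ) (G : BraidGroup n) :
    invR S ν G * scale 1 ν⁻¹ (PhiR S G) = 1 := by
  rw [invR, scale_mul, phi_PhiR_inv_mul, scale_one]

theorem mul_invR (ν : Fin n → Sˣ) (G : BraidGroup n) :
    scale 1 ν⁻¹ (PhiR S G) * invR S ν G = 1 := by
  rw [invR, scale_mul, PhiR_mul_phi_inv, scale_one]

theorem reflectedGen_of_deg_eq_zero (mu : Sˣ) (U V : S) (ν : Fin n → Sˣ) (G : BraidGroup n)
    (x : Gen n) (hx : x.deg = 0) : reflectedGen mu U V ν G x = 0 := by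
  cases x <;> simp_all [Gen.deg, reflectedGen]

variable (mu : Sˣ) (U V : S) (ν : Fin n → Sˣ) (G : BraidGroup n)

/-- The differential with values `reflectedGen`. -/
def reflectedDiff : CT S n →ₗ[S] CT S n := diffOf Gen.deg (reflectedGen mu U V ν G)

theorem reflectedDiff_ctB : (reflectedDiff mu U V ν G).mapMatrix (ctB S n) =
    ctA S n - scale ν⁻¹ ν⁻¹ (ctPhiA S G) := by
  ext i j
  rw [LinearMap.mapMatrix_apply, Matrix.map_apply, ctB]
  by_cases h : i = j
  -- The diagonal entries −2 of 𝐀 and φ_G(𝐀) cancel, in agreement with 𝐁_{ii} = 0.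
  · subst h
    simp [ctA, ctPhiA, scale, matA_self, map_ofNat]
  · rw [dif_pos h, reflectedDiff, diffOf_ι]
    rfl

theorem reflectedDiff_ctC : (reflectedDiff mu U V ν G).mapMatrix (ctC S n) =
    hatA mu U n - checkA mu V n * scale 1 ν⁻¹ (ctPhiR S G) := by
  ext i j
  rw [LinearMap.mapMatrix_apply, Matrix.map_apply, ctC, reflectedDiff, diffOf_ι]
  rfl

theorem reflectedDiff_ctD : (reflectedDiff mu U V ν G).mapMatrix (ctD S n) =
    checkA mu V n - scale ν⁻¹ 1 (ctPhiL S G) * hatA mu U n := by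
  ext i j
  rw [LinearMap.mapMatrix_apply, Matrix.map_apply, ctD, reflectedDiff, diffOf_ι]
  rfl

theorem reflectedDiff_ctE : (reflectedDiff mu U V ν G).mapMatrix (ctE S n) =
    hatB mu U n - ctC S n - ctD S n * scale 1 ν⁻¹ (ctPhiR S G) := by
  ext i j
  rw [LinearMap.mapMatrix_apply, Matrix.map_apply, ctE, reflectedDiff, diffOf_ι]
  rfl

theorem reflectedDiff_ctF : (reflectedDiff mu U V ν G).mapMatrix (ctF S n) =
    checkB mu V n - ctD S n - scale ν⁻¹ 1 (ctPhiL S G) * ctC S n := by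
  ext i j
  rw [LinearMap.mapMatrix_apply, Matrix.map_apply, ctF, reflectedDiff, diffOf_ι]
  rfl

theorem reflectedDiff_mul (X Y : Matrix (Fin n) (Fin n) (AAlg S (Fin n)))
    (Z : Matrix (Fin n) (Fin n) (CT S n)) :
    (reflectedDiff mu U V ν G).mapMatrix ((toCT S n).mapMatrix X * Z * (toCT S n).mapMatrix Y) =
      (toCT S n).mapMatrix X * (reflectedDiff mu U V ν G).mapMatrix Z * (toCT S n).mapMatrix Y :=
  mapMatrix_diffOf_mul (reflectedGen_of_deg_eq_zero mu U V ν G) X Y Z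

/-- The isomorphism on the `a_{ij}`: apply `φ_G` and rescale. -/
def baseEquiv (κ : Fin n → Sˣ) (G : BraidGroup n) : AAlg S (Fin n) ≃ₐ[S] AAlg S (Fin n) :=
  (phi S n G).trans (gaugeEquiv κ)

variable (lam : Sˣ) (κ : Fin n → Sˣ)

/-- The homomorphism `CT^-(G⁻¹) → CT^-` that intertwines `∂^-(G⁻¹)` with the reflected
differential of `G`. -/
def mirrorHom : CT S n →ₐ[S] CT S n :=
  blockHom mu U V (baseEquiv κ G : AAlg S (Fin n) →ₐ[S] AAlg S (Fin n)) (lamDiag lam mu G⁻¹ * κ)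
    (invL S ν G) 1 1 (invR S ν G)

/-- The inverse of `mirrorHom`. -/
def mirrorHomInv : CT S n →ₐ[S] CT S n :=
  blockHom mu U V ((baseEquiv κ G).symm : AAlg S (Fin n) →ₐ[S] AAlg S (Fin n))
    -- Solving the formula for the image of 𝐂 for 𝐃, and that of 𝐃 for 𝐂, replaces L⁻¹ and R⁻¹ by L
    -- and R, moved to the other block. They are transported to the source by the inverse map on the
    -- a_{ij} and conjugated by N = Λκ.
    (lamDiag lam mu G⁻¹ * κ)⁻¹ 1
    (scale (lamDiag lam mu G⁻¹ * κ) (lamDiag lam mu G⁻¹ * κ)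
      ((baseEquiv κ G).symm.toAlgHom.mapMatrix (scale 1 ν⁻¹ (PhiR S G))))
    (scale (lamDiag lam mu G⁻¹ * κ) (lamDiag lam mu G⁻¹ * κ)
      ((baseEquiv κ G).symm.toAlgHom.mapMatrix (scale ν⁻¹ 1 (PhiL S G)))) 1

theorem mirrorHomInv_comp_mirrorHom :
    (mirrorHomInv mu U V ν G lam κ).comp (mirrorHom mu U V ν G lam κ) = AlgHom.id S _ := by
  refine blockHom_comp_blockHom mu U V (fun x => (baseEquiv κ G).symm_apply_apply x) ?_ ?_ ?_ ?_
  · rw [scale_scale, inv_mul_cancel, scale_one_one]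
    exact (map_mul _ _ _).symm.trans (by rw [invL_mul, map_one])
  · rw [scale_one, map_one, one_mul]
  · rw [scale_one, map_one, one_mul]
  · rw [scale_scale, inv_mul_cancel, scale_one_one]
    exact (map_mul _ _ _).symm.trans (by rw [mul_invR, map_one])

theorem mirrorHom_comp_mirrorHomInv :
    (mirrorHom mu U V ν G lam κ).comp (mirrorHomInv mu U V ν G lam κ) = AlgHom.id S _ := by
  have key : ∀ M : Matrix (Fin n) (Fin n) (AAlg S (Fin n)),
      (baseEquiv κ G : AAlg S (Fin n) →ₐ[S] AAlg S (Fin n)).mapMatrix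
        ((baseEquiv κ G).symm.toAlgHom.mapMatrix M) = M := by
    intro M
    ext i j
    exact (baseEquiv κ G).apply_symm_apply _
  have h := blockHom_comp_blockHom (ν := (lamDiag lam mu G⁻¹ * κ)⁻¹) (X₁ := 1) (Y₂ := 1)
    (Y₁ := scale (lamDiag lam mu G⁻¹ * κ) (lamDiag lam mu G⁻¹ * κ)
      ((baseEquiv κ G).symm.toAlgHom.mapMatrix (scale 1 ν⁻¹ (PhiR S G))))
    (X₂ := scale (lamDiag lam mu G⁻¹ * κ) (lamDiag lam mu G⁻¹ * κ)
      ((baseEquiv κ G).symm.toAlgHom.mapMatrix (scale ν⁻¹ 1 (PhiL S G))))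
    (X₁' := invL S ν G) (Y₁' := 1) (X₂' := 1) (Y₂' := invR S ν G)
    (θ := ((baseEquiv κ G).symm : AAlg S (Fin n) →ₐ[S] AAlg S (Fin n)))
    (θ' := (baseEquiv κ G : AAlg S (Fin n) →ₐ[S] AAlg S (Fin n)))
    mu U V (fun x => (baseEquiv κ G).apply_symm_apply x) ?_ ?_ ?_ ?_
  · rwa [inv_inv] at h
  · rw [scale_one, map_one, one_mul]
  · rw [inv_inv, mapMatrix_scale]
    erw [key]
    rw [scale_mul, invR_mul, scale_one]
  · rw [inv_inv, mapMatrix_scale]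
    erw [key]
    rw [scale_mul, mul_invL, scale_one]
  · rw [scale_one, map_one, one_mul]

variable {G ν lam κ}
-- The condition on κ in the form κ∘π = NΛ'⁻¹ with N = Λκ. It lets all weights in the images under
-- `mirrorHom` be written as a conjugation by the single diagonal matrix N.
theorem comp_permHom_eq
    (hκ : ∀ i, κ (permHom n G i) = κ i * (lamDiag lam mu G⁻¹ i * (ν i)⁻¹)) :
    κ ∘ permHom n G = lamDiag lam mu G⁻¹ * κ * ν⁻¹ := by
  funext i
  rw [Function.comp_apply, hκ, Pi.mul_apply, Pi.mul_apply, Pi.inv_apply, mul_comm (κ i),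
    mul_right_comm]

/-- The image Nφ_G-conjugate Λ'⁻¹φ_G(𝐀)Λ' is exactly 𝐀 − δ𝐁. In this form the formula passes
entrywise to Â and Ǎ, with B̂ and B̌ as correction terms. -/
theorem mirrorHom_ctA
    (hκ : ∀ i, κ (permHom n G i) = κ i * (lamDiag lam mu G⁻¹ i * (ν i)⁻¹)) :
    (mirrorHom mu U V ν G lam κ).mapMatrix (ctA S n) =
    scale (lamDiag lam mu G⁻¹ * κ) (lamDiag lam mu G⁻¹ * κ)
      (ctA S n - (reflectedDiff mu U V ν G).mapMatrix (ctB S n)) := by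
  rw [reflectedDiff_ctB, sub_sub_cancel, scale_scale, ← comp_permHom_eq mu hκ]
  ext i j
  change mirrorHom mu U V ν G lam κ (toCT S n (matA S (Fin n) i j)) = _
  rw [mirrorHom, blockHom_toCT]
  change toCT S n (gauge S κ (phi S n G _)) = _
  rw [gauge_phi_matA, map_smul]
  rfl

theorem mirrorHom_ctPhiA :
    (mirrorHom mu U V ν G lam κ).mapMatrix (ctPhiA S G⁻¹) = scale κ κ (ctA S n) := by
  ext i j
  change mirrorHom mu U V ν G lam κ (toCT S n (phi S n G⁻¹ (matA S (Fin n) i j))) = _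
  rw [mirrorHom, blockHom_toCT]
  change toCT S n (gauge S κ (phi S n G _)) = _
  rw [phi_phi_inv, gauge_matA, map_smul]
  rfl

/-- φ_G(Φ^L_{G⁻¹}) is the inverse of Φ^L_G, with rescaling weights κ on the rows and κ∘π on the
columns. The factor Λ turns the row weights into N, and the condition on κ turns the column weights
into NΛ'⁻¹, whose second factor is absorbed in the inverse of Λ'⁻¹Φ^L_G. -/
theorem mirrorHom_ctPhiL
    (hκ : ∀ i, κ (permHom n G i) = κ i * (lamDiag lam mu G⁻¹ i * (ν i)⁻¹)) :
   
    (mirrorHom mu U V ν G lam κ).mapMatrix (scale (lamDiag lam mu G⁻¹) 1 (ctPhiL S G⁻¹)) =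
      scale (lamDiag lam mu G⁻¹ * κ) (lamDiag lam mu G⁻¹ * κ)
        ((toCT S n).mapMatrix (invL S ν G)) := by
  have h : (mirrorHom mu U V ν G lam κ).mapMatrix (ctPhiL S G⁻¹) = (toCT S n).mapMatrix
      ((gauge S κ).mapMatrix ((PhiL S G⁻¹).map (phi S n G))) :=
    blockHom_mapMatrix_toCT mu U V _ _ _ _ _ _ (PhiL S G⁻¹)
  rw [mapMatrix_scale, h, gauge_mapMatrix_inv_PhiL, mapMatrix_scale, scale_scale, one_mul,
    comp_permHom_eq mu hκ, invL, mapMatrix_scale, scale_scale, mul_one]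

theorem mirrorHom_ctPhiR
    (hκ : ∀ i, κ (permHom n G i) = κ i * (lamDiag lam mu G⁻¹ i * (ν i)⁻¹)) :
   
    (mirrorHom mu U V ν G lam κ).mapMatrix (scale 1 (lamDiag lam mu G⁻¹) (ctPhiR S G⁻¹)) =
      scale (lamDiag lam mu G⁻¹ * κ) (lamDiag lam mu G⁻¹ * κ)
        ((toCT S n).mapMatrix (invR S ν G)) := by
  have h : (mirrorHom mu U V ν G lam κ).mapMatrix (ctPhiR S G⁻¹) = (toCT S n).mapMatrix
      ((gauge S κ).mapMatrix ((PhiR S G⁻¹).map (phi S n G))) :=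
    blockHom_mapMatrix_toCT mu U V _ _ _ _ _ _ (PhiR S G⁻¹)
  rw [mapMatrix_scale, h, gauge_mapMatrix_inv_PhiR, mapMatrix_scale, scale_scale, one_mul,
    comp_permHom_eq mu hκ, invR, mapMatrix_scale, scale_scale, mul_one]

theorem mirrorHom_hatA
    (hκ : ∀ i, κ (permHom n G i) = κ i * (lamDiag lam mu G⁻¹ i * (ν i)⁻¹)) :
    (mirrorHom mu U V ν G lam κ).mapMatrix (hatA mu U n) =
    scale (lamDiag lam mu G⁻¹ * κ) (lamDiag lam mu G⁻¹ * κ)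
      (hatA mu U n - (reflectedDiff mu U V ν G).mapMatrix (hatB mu U n)) := by
  rw [hatA_eq_tri, mapMatrix_tri, mirrorHom_ctA mu U V hκ, ← scale_tri, tri_sub, hatB_eq_tri,
    mapMatrix_linearMap_tri]

theorem mirrorHom_checkA
    (hκ : ∀ i, κ (permHom n G i) = κ i * (lamDiag lam mu G⁻¹ i * (ν i)⁻¹)) :
    (mirrorHom mu U V ν G lam κ).mapMatrix (checkA mu V n) =
    scale (lamDiag lam mu G⁻¹ * κ) (lamDiag lam mu G⁻¹ * κ)
      (checkA mu V n - (reflectedDiff mu U V ν G).mapMatrix (checkB mu V n)) := by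
  rw [checkA_eq_tri, mapMatrix_tri, mirrorHom_ctA mu U V hκ, ← scale_tri, tri_sub, checkB_eq_tri,
    mapMatrix_linearMap_tri]

/-- All images share the conjugation by N, which can be stripped off. What remains are identities
between matrices that use only L⁻¹L = 1, RR⁻¹ = 1 and linearity of δ over degree 0. -/
theorem mirrorHom_diffGen
    (hκ : ∀ i, κ (permHom n G i) = κ i * (lamDiag lam mu G⁻¹ i * (ν i)⁻¹))
    (x : Gen n) :
    mirrorHom mu U V ν G lam κ (diffGen lam mu U V G⁻¹ x) =
      reflectedDiff mu U V ν G (mirrorHom mu U V ν G lam κ (FreeAlgebra.ι S x)) := by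
  set Ψ := mirrorHom mu U V ν G lam κ with hΨ
  set δ := reflectedDiff mu U V ν G with hδ
  set N := lamDiag lam mu G⁻¹ * κ with hN
  set T := (toCT S n).mapMatrix (m := Fin n) with hT
  set l := scale ν⁻¹ 1 (ctPhiL S G) with hl
  set r := scale 1 ν⁻¹ (ctPhiR S G) with hr
  have il : T (invL S ν G) * l = 1 := by
    have := congrArg T (invL_mul (S := S) ν G)
    rwa [map_mul, map_one, hT, mapMatrix_scale] at this
  have ri : r * T (invR S ν G) = 1 := by
    have := congrArg T (mul_invR (S := S) ν G)
    rwa [map_mul, map_one, hT, mapMatrix_scale] at this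
  have hB : Ψ.mapMatrix (ctB S n) = -scale N N (ctB S n) := blockHom_ctB ..
  have hC : Ψ.mapMatrix (ctC S n) = scale N N (-hatB mu U n +
      T (invL S ν G) * (checkB mu V n - ctD S n) * T 1) := blockHom_ctC ..
  have hD : Ψ.mapMatrix (ctD S n) = scale N N (-checkB mu V n +
      T 1 * (hatB mu U n - ctC S n) * T (invR S ν G)) := blockHom_ctD ..
  have hE : Ψ.mapMatrix (ctE S n) = -scale N N (T (invL S ν G * 1) * ctE S n *
      T (1 * invR S ν G)) := blockHom_ctE ..
  have hF : Ψ.mapMatrix (ctF S n) = -scale N N (T (invL S ν G * 1) * ctF S n *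
      T (1 * invR S ν G)) := blockHom_ctF ..
  have hHB : Ψ.mapMatrix (hatB mu U n) = -scale N N (hatB mu U n) := blockHom_hatB ..
  have hKB : Ψ.mapMatrix (checkB mu V n) = -scale N N (checkB mu V n) := blockHom_checkB ..
  have hdC := reflectedDiff_ctC mu U V ν G
  have hdD := reflectedDiff_ctD mu U V ν G
  have hdE := reflectedDiff_ctE mu U V ν G
  have hdF := reflectedDiff_ctF mu U V ν G
  have hm := reflectedDiff_mul mu U V ν G
  have hA := mirrorHom_ctA mu U V hκ
  have hPA := mirrorHom_ctPhiA mu U V (G := G) (ν := ν) (lam := lam) (κ := κ)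
  have hL := mirrorHom_ctPhiL mu U V hκ
  have hR := mirrorHom_ctPhiR mu U V hκ
  have hHA := mirrorHom_hatA mu U V hκ
  have hKA := mirrorHom_checkA mu U V hκ
  rw [← hΨ, ← hN, ← hδ] at hA hHA hKA
  rw [← hΨ] at hPA
  rw [← hΨ, ← hN] at hL hR
  simp only [← hδ, ← hl, ← hr, ← hT] at hdC hdD hdE hdF hm hL hR
  simp only [mul_one, one_mul, map_one] at hC hD hE hF
  have hm1 := fun X Z => hm X 1 Z
  have hm2 := fun Y Z => hm 1 Y Z
  simp only [mul_one, one_mul, map_one] at hm1 hm2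
  cases x with
  | a i j h =>
    have e : Ψ (FreeAlgebra.ι S (Gen.a i j h)) = toCT S n (baseEquiv κ G (matA S (Fin n) i j)) := by
      rw [← toCT_matA]; exact blockHom_toCT ..
    rw [diffGen, map_zero, e]
    exact (diffOf_degreePart_zero (reflectedGen_of_deg_eq_zero mu U V ν G)
      (toCT_mem_degreePart _)).symm
  | b i j h =>
    have e : Ψ.mapMatrix (ctA S n - Lam lam mu G⁻¹ * ctPhiA S G⁻¹ * LamInv lam mu G⁻¹) =
        δ.mapMatrix (Ψ.mapMatrix (ctB S n)) := by
      -- Here Ψ(𝐀) = N(𝐀 − δ𝐁)N⁻¹, while the second term of ∂𝐁 becomes N𝐀N⁻¹. The difference is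
      -- −N(δ𝐁)N⁻¹, which accounts for the sign in 𝐁 ↦ −𝐁.
      rw [mul_LamInv, Lam_mul, scale_scale, one_mul, mul_one, map_sub, mapMatrix_scale, hPA, hA,
        scale_scale, hB, map_neg, mapMatrix_linearMap_scale, scale_sub, sub_sub_cancel_left]
    have := congrFun (congrFun e i) j
    simp only [LinearMap.mapMatrix_apply, AlgHom.mapMatrix_apply, Matrix.map_apply, ctB,
      dif_pos h] at this
    exact this
  | c i j =>
    have e : Ψ.mapMatrix (hatA mu U n - Lam lam mu G⁻¹ * ctPhiL S G⁻¹ * checkA mu V n) =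
        δ.mapMatrix (Ψ.mapMatrix (ctC S n)) := by
      rw [Lam_mul, map_sub, map_mul, hL, hHA, hKA, scale_mul, ← scale_sub, hC,
        mapMatrix_linearMap_scale, map_add, map_neg, hm1, map_sub δ.mapMatrix, hdD]
      congr 1
      -- The term −LÂ in δ𝐃 is what produces Â here, once multiplied by L⁻¹.
      have h1 : T (invL S ν G) * (l * hatA mu U n) = hatA mu U n := by
        rw [← mul_assoc, il, one_mul]
      simp only [mul_sub, h1]
      abel
    exact congrFun (congrFun e i) j
  | d i j =>
    have e : Ψ.mapMatrix (checkA mu V n - hatA mu U n * ctPhiR S G⁻¹ * LamInv lam mu G⁻¹) =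
        δ.mapMatrix (Ψ.mapMatrix (ctD S n)) := by
      rw [mul_LamInv, mul_scale_one, map_sub, map_mul, hR, hHA, hKA, scale_mul, ← scale_sub, hD,
        mapMatrix_linearMap_scale, map_add, map_neg, hm2, map_sub δ.mapMatrix, hdC]
      congr 1
      have h1 : checkA mu V n * r * T (invR S ν G) = checkA mu V n := by
        rw [mul_assoc, ri, mul_one]
      simp only [sub_mul, h1]
      abel
    exact congrFun (congrFun e i) j
  | e i j =>
    have e : Ψ.mapMatrix (hatB mu U n - ctC S n - Lam lam mu G⁻¹ * ctPhiL S G⁻¹ * ctD S n) =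
        δ.mapMatrix (Ψ.mapMatrix (ctE S n)) := by
      rw [Lam_mul, map_sub, map_sub, map_mul, hL, hHB, hC, hD, scale_mul, ← scale_neg, ← scale_sub,
        ← scale_sub, hE, map_neg, mapMatrix_linearMap_scale, hm, hdE, ← scale_neg]
      congr 1
      -- After B̂ and L⁻¹B̌ cancel, the left side is L⁻¹𝐃 − L⁻¹(B̂ − 𝐂)R⁻¹. Writing L⁻¹𝐃 as
      -- L⁻¹(𝐃R)R⁻¹ identifies it with −L⁻¹(δ𝐄)R⁻¹.
      have h1 : T (invL S ν G) * (ctD S n * r) * T (invR S ν G) = T (invL S ν G) * ctD S n := by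
        rw [mul_assoc, mul_assoc (ctD S n), ri, mul_one]
      simp only [mul_sub, sub_mul, mul_add, mul_neg]
      simp only [mul_assoc] at h1 ⊢
      rw [h1]
      abel
    exact congrFun (congrFun e i) j
  | f i j =>
    have e : Ψ.mapMatrix (checkB mu V n - ctD S n - ctC S n * ctPhiR S G⁻¹ * LamInv lam mu G⁻¹) =
        δ.mapMatrix (Ψ.mapMatrix (ctF S n)) := by
      rw [mul_LamInv, mul_scale_one, map_sub, map_sub, map_mul, hR, hKB, hC, hD, scale_mul,
        ← scale_neg, ← scale_sub, ← scale_sub, hF, map_neg, mapMatrix_linearMap_scale, hm, hdF,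
        ← scale_neg]
      congr 1
      have h1 : T (invL S ν G) * (l * ctC S n) * T (invR S ν G) = ctC S n * T (invR S ν G) := by
        rw [← mul_assoc, il, one_mul]
      simp only [mul_sub, sub_mul, add_mul, neg_mul, h1]
      abel
    exact congrFun (congrFun e i) j

/-- `mirrorHom` as an isomorphism. -/
def mirrorEquiv (mu : Sˣ) (U V : S) (ν : Fin n → Sˣ) (G : BraidGroup n) (lam : Sˣ)
    (κ : Fin n → Sˣ) : CT S n ≃ₐ[S] CT S n :=
  AlgEquiv.ofAlgHom (mirrorHom mu U V ν G lam κ) (mirrorHomInv mu U V ν G lam κ)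
    (mirrorHom_comp_mirrorHomInv mu U V ν G lam κ) (mirrorHomInv_comp_mirrorHom mu U V ν G lam κ)

variable (S n) in
/-- `reflectHom` as an isomorphism. -/
def reflectEquiv : CT S n ≃ₐ[S] CT S n :=
  AlgEquiv.ofAlgHom (reflectHom S n) (reflectHom S n) reflectHom_comp_self reflectHom_comp_self

/-- A degree-preserving isomorphism maps each homogeneous part onto the homogeneous part. -/
theorem map_degreePart_eq {X : Type*} {deg : X → ℕ} (f : FreeAlgebra S X ≃ₐ[S] FreeAlgebra S X)
    (h : ∀ x, f (FreeAlgebra.ι S x) ∈ degreePart S deg (deg x))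
    (h' : ∀ x, f.symm (FreeAlgebra.ι S x) ∈ degreePart S deg (deg x)) (k : ℕ) :
    (degreePart S deg k).map f.toLinearMap = degreePart S deg k := by
  apply le_antisymm
  · rintro _ ⟨y, hy, rfl⟩
    exact map_mem_degreePart (f : FreeAlgebra S X →ₐ[S] FreeAlgebra S X) h hy
  · intro y hy
    exact ⟨f.symm y, map_mem_degreePart (f.symm : FreeAlgebra S X →ₐ[S] FreeAlgebra S X) h' hy,
      f.apply_symm_apply y⟩

/-- The rescaling that carries the marked strand of a knot from one end to the other. -/
theorem exists_rescaling {B : BraidGroup n} (hB : ClosureIsKnot B) (lam mu : Sˣ) :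
    ∃ κ : Fin n → Sˣ, ∀ i, κ (permHom n (braidStar n B) i) =
      κ i * (lamDiag lam mu (braidStar n B)⁻¹ i * (lamDiag lam mu B i.rev)⁻¹) := by
  rcases n with _ | n
  · exact ⟨1, fun i => i.elim0⟩
  -- Here the knot hypothesis enters: Λ is marked at strand 0 and the reflected Λ_B at the last
  -- strand, and both must lie on one cycle of the permutation of B^*.
  have hs : (permHom (n + 1) (braidStar (n + 1) B)).SameCycle 0 (Fin.last n) := by
    rw [permHom_braidStar, Equiv.Perm.sameCycle_conj]
    exact hB.sameCycle _ _
  obtain ⟨κ, hκ⟩ := exists_cochain _ hs (lam * mu ^ (-writhe B))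
  refine ⟨κ, fun i => ?_⟩
  rw [hκ, lamDiag, lamDiag, writhe_braidStar_inv]
  have h0 : ((i : ℕ) = 0) ↔ i = 0 := Fin.val_eq_zero_iff
  have h1 : ((i.rev : Fin (n + 1)) : ℕ) = 0 ↔ i = Fin.last n := by
    rw [Fin.ext_iff, Fin.val_rev, Fin.val_last]; omega
  simp only [h0, h1]

/-- The coefficient ring and its parameters are arbitrary: the argument uses only that λ and μ are
units. -/
theorem exists_mirror_iso (lam mu : Sˣ) (U V : S) {B : BraidGroup n} (hB : ClosureIsKnot B) :
    ∃ Ψ : CT S n ≃ₐ[S] CT S n,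
      (∀ k : ℕ, (degreePart S Gen.deg k).map Ψ.toLinearMap = degreePart S Gen.deg k) ∧
      ∀ x : CT S n, Ψ (diffCT lam mu U V (braidStar n B)⁻¹ x) = diffOpCT lam mu U V B (Ψ x) := by
  obtain ⟨κ, hκ⟩ := exists_rescaling hB lam mu
  set ν : Fin n → Sˣ := lamDiag lam mu B ∘ Fin.rev with hν
  have hr : ∀ x : Gen n, reflectHom S n (FreeAlgebra.ι S x) ∈ degreePart S Gen.deg x.deg := by
    intro x
    rw [reflectHom_ι, ← Gen.deg_reflect]
    exact ι_mem_degreePart _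
  refine ⟨(mirrorEquiv mu U V ν (braidStar n B) lam κ).trans (reflectEquiv S n),
    map_degreePart_eq _ (fun x => ?_) (fun x => ?_), fun x => ?_⟩
  · exact map_mem_degreePart (reflectHom S n) hr
      (blockHom_ι_mem_degreePart _ _ _ _ _ _ _ _ _ x)
  · exact map_mem_degreePart (mirrorHomInv mu U V ν (braidStar n B) lam κ)
      (blockHom_ι_mem_degreePart _ _ _ _ _ _ _ _ _) (hr x)
  · have h := map_diffOf_of_generators (D := diffGen lam mu U V (braidStar n B)⁻¹)
      (D' := reflectedGen mu U V ν (braidStar n B)) (mirrorHom mu U V ν (braidStar n B) lam κ)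
      (blockHom_ι_mem_degreePart _ _ _ _ _ _ _ _ _) (mirrorHom_diffGen mu U V hκ) x
    exact (congrArg (reflectHom S n) h).trans (reflectHom_diffOf lam mu U V B _)

end Isomorphism

end

end TransverseHomology

/-- If the closure of `B` is a knot, then `(B^*)⁻¹` represents the transverse mirror of the
transverse knot represented by `B`, and there is a degree-preserving isomorphism of
`R[U,V]`-algebras intertwining `∂^-((B^*)⁻¹)` with `∂^-_op(B)`. -/
theorem proposition4p5 (n : ℕ) (B : BraidGroup n) (hB : ClosureIsKnot B) :
    transverseClosure (braidStar n B)⁻¹ = (transverseClosure B).mirror ∧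
    ∃ Ψ : CT RUV n ≃ₐ[RUV] CT RUV n,
      (∀ k : ℕ, (degreePart RUV Gen.deg k).map Ψ.toLinearMap = degreePart RUV Gen.deg k) ∧
      ∀ x : CT RUV n, Ψ (dMinus (braidStar n B)⁻¹ x) = dMinusOp B (Ψ x) := by
  obtain ⟨Ψ, hdeg, hdiff⟩ := exists_mirror_iso lamRUV muRUV URUV VRUV hB
  exact ⟨transverseClosure_braidStar_inv B, Ψ, hdeg, hdiff⟩
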